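/- For $q\in[0,1]$ and $\rho\in\big[-\min\{\tfrac{q}{1-q},\tfrac{1-q}{q}\},1\big]$ let $\mathsf p_{q,\rho}$ be the joint law of two Bernoulli variables with success probability $q$ and correlation coefficient $\rho$, i.e. the law on $\{0,1\}^2$ with $\mathsf p(0,0)=(1-q)(1-q+\rho q)$, $\mathsf p(1,0)=\mathsf p(0,1)=q(1-q)(1-\rho)$, $\mathsf p(1,1)=q(q+\rho(1-q))$. Let $\mathsf P_{X,Y}=\mathsf p_{q,\rho}^{\otimes d}$, a law on $\{0,1\}^d\times\{0,1\}^d$, with marginals $\mathsf P_X,\mathsf P_Y$. One observes $(X_1,\dots,X_n)$ and $(Y_1,\dots,Y_m)$, $m\le n$, under one of two hypotheses. Under $\mathcal H_0$ all observations are independent with $X_j\sim\mathsf P_X$ and $Y_i\sim\mathsf P_Y$. Under $\mathcal H_1$ an injection $\pi:[m]\to[n]$ is drawn uniformly at random and, conditionally on $\pi$, the pairs $(X_{\pi(i)},Y_i)$, $i\in[m]$, are i.i.d. from $\mathsf P_{X,Y}$ and, independently, the $X_j$ with $j\notin\pi([m])$ are i.i.d. from $\mathsf P_X$. Fix a constant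 $\alpha\in(0,1]$, let $n$ run through any sequence of natural numbers tending to infinity, let $m=\lfloor\alpha n\rfloor$ (so $m=\alpha n$ whenever $\alpha n$ is an integer), and let $q\in[0,1/2]$ and $\rho$, with $(q,\rho)$ in the above range, vary along the sequence. Strong detection is said to be possible if there are tests, which may depend on all of these parameters, whose Type-I and Type-II error probabilities both tend to $0$ along the sequence. Then: 1. (Fixed $d$.) If $d\ge1$ is constant, strong detection is possible if and only if $\alpha=1$, $\rho^2\to1$ and $nq\to\infty$. 2. (Growing $d$.) If $d\to\infty$ along the sequence, strong detection is possible if and only if $\rho^2d\to\infty$ and $ndq|\rho|\to\infty$. -/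

import Mathlib

open MeasureTheory Filter Topology
open scoped ENNReal

namespace BrokenSample

variable {X Y : Type*} [MeasurableSpace X] [MeasurableSpace Y] {n m : ℕ}

/-- The law of the data `(X₁, …, Xₙ), (Y₁, …, Yₘ)` under the null hypothesis: all entries are
independent, `Xⱼ ∼ P_X` and `Yᵢ ∼ P_Y`, where `P_X`, `P_Y` are the marginals of `P`. -/
noncomputable def nullLaw (P : Measure (X × Y)) (n m : ℕ) :
    Measure ((Fin n → X) × (Fin m → Y)) :=
  (Measure.pi fun _ : Fin n => P.fst).prod (Measure.pi fun _ : Fin m => P.snd)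

open Classical in
/-- The data set with `(X_{π(i)}, Yᵢ) = zᵢ` for every `i`, and with `Xⱼ = wⱼ` for every `j` outside
the range of `π`. -/
noncomputable def assemble (π : Fin m ↪ Fin n)
    (zw : (Fin m → X × Y) × ({j : Fin n // j ∉ Set.range π} → X)) :
    (Fin n → X) × (Fin m → Y) :=
  (fun j => if h : j ∈ Set.range π then (zw.1 h.choose).1 else zw.2 ⟨j, h⟩,
    fun i => (zw.1 i).2)

/-- The law of the data under the alternative hypothesis, conditionally on the latent
injection `π`: the pairs `(X_{π(i)}, Yᵢ)` are drawn i.i.d. from `P`, and the remaining `Xⱼ` are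
drawn i.i.d. from `P_X`, independently of the pairs. -/
noncomputable def altLawGiven (P : Measure (X × Y)) (π : Fin m ↪ Fin n) :
    Measure ((Fin n → X) × (Fin m → Y)) :=
  ((Measure.pi fun _ : Fin m => P).prod
    (Measure.pi fun _ : {j : Fin n // j ∉ Set.range π} => P.fst)).map (assemble π)

/-- The law of the data under the alternative hypothesis: the mixture of the conditional laws over
a uniformly random injection `π : [m] → [n]`. -/
noncomputable def altLaw (P : Measure (X × Y)) (n m : ℕ) :
    Measure ((Fin n → X) × (Fin m → Y)) :=
  (Fintype.card (Fin m ↪ Fin n) : ℝ≥0∞)⁻¹ • ∑ π : Fin m ↪ Fin n, altLawGiven P π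

/-- Strong detection is possible along a sequence of problems (joint distribution `P k`, sample
sizes `n k` and `m k`): there are tests, given by their rejection regions `T k`, whose Type-I and
Type-II error probabilities both vanish. -/
def StrongDetection {X Y : ℕ → Type*} [∀ k, MeasurableSpace (X k)] [∀ k, MeasurableSpace (Y k)]
    (P : ∀ k, Measure (X k × Y k)) (n m : ℕ → ℕ) : Prop :=
  ∃ T : ∀ k, Set ((Fin (n k) → X k) × (Fin (m k) → Y k)),
    (∀ k, MeasurableSet (T k)) ∧
    Tendsto (fun k => nullLaw (P k) (n k) (m k) (T k)) atTop (𝓝 0) ∧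
    Tendsto (fun k => altLaw (P k) (n k) (m k) (T k)ᶜ) atTop (𝓝 0)

/-- The joint probability mass function of two Bernoulli random variables with success
probability `q` and correlation coefficient `ρ`; `true` stands for `1`. -/
def pairMass (q ρ : ℝ) : Bool × Bool → ℝ
  | (false, false) => (1 - q) * (1 - q + ρ * q)
  | (true, false) => q * (1 - q) * (1 - ρ)
  | (false, true) => q * (1 - q) * (1 - ρ)
  | (true, true) => q * (q + ρ * (1 - q))

/-- The joint distribution of two `ρ`-correlated Bernoulli variables of success probability `q`. -/
noncomputable def pairLaw (q ρ : ℝ) : Measure (Bool × Bool) :=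
  ∑ z : Bool × Bool, ENNReal.ofReal (pairMass q ρ z) • Measure.dirac z

/-- The joint distribution of `(X, Y)` in the Bernoulli model: `X` and `Y` lie in `{0,1}^d`, and the
pairs of coordinates are independent `ρ`-correlated Bernoulli variables. -/
noncomputable def bernoulliModel (d : ℕ) (q ρ : ℝ) :
    Measure ((Fin d → Bool) × (Fin d → Bool)) :=
  (Measure.pi fun _ : Fin d => pairLaw q ρ).map
    fun z => (fun j => (z j).1, fun j => (z j).2)

/-- The parameters for which the mass function above is one of a probability distribution. -/
def Admissible (q ρ : ℝ) : Prop :=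
  0 ≤ q ∧ q ≤ 1 ∧ -min (q / (1 - q)) ((1 - q) / q) ≤ ρ ∧ ρ ≤ 1

theorem measurable_assemble (π : Fin m ↪ Fin n) :
    Measurable (assemble π : (Fin m → X × Y) × ({j : Fin n // j ∉ Set.range π} → X) → _) := by
  refine Measurable.prodMk (measurable_pi_lambda _ fun j => ?_)
    (measurable_pi_lambda _ fun i => by fun_prop)
  by_cases h : j ∈ Set.range π
  · simp only [h, dite_true]; fun_prop
  · simp only [h, dite_false]; fun_prop

/-- Under the alternative given `π`, the pairs `(X_{π(i)}, Yᵢ)` and the unmatched `Xⱼ` have the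
prescribed product law. -/
theorem map_altLawGiven (P : Measure (X × Y)) (π : Fin m ↪ Fin n) :
    (altLawGiven P π).map (fun xy => (fun i => (xy.1 (π i), xy.2 i),
        fun j : {j : Fin n // j ∉ Set.range π} => xy.1 j)) =
      (Measure.pi fun _ : Fin m => P).prod
        (Measure.pi fun _ : {j : Fin n // j ∉ Set.range π} => P.fst) := by
  rw [altLawGiven, Measure.map_map (by fun_prop) (measurable_assemble π)]
  convert Measure.map_id
  funext zw
  refine Prod.ext (funext fun i => ?_) (funext fun j => ?_)
  · have h : π i ∈ Set.range π := ⟨i, rfl⟩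
    have h2 : h.choose = i := π.injective h.choose_spec
    simp only [assemble, Function.comp, h, dite_true, id, h2]
  · simp only [assemble, Function.comp, j.2, dite_false, id]

theorem pairMass_nonneg {q ρ : ℝ} (h : Admissible q ρ) (z : Bool × Bool) :
    0 ≤ pairMass q ρ z := by
  obtain ⟨h0, h1, h2, h3⟩ := h
  have h4 : 0 ≤ 1 - q := by linarith
  have ha : -(q / (1 - q)) ≤ ρ := (neg_le_neg (min_le_left _ _)).trans h2
  have hb : -((1 - q) / q) ≤ ρ := (neg_le_neg (min_le_right _ _)).trans h2
  have hA : 0 ≤ (1 - q + ρ * q) := by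
    rcases h0.eq_or_lt with rfl | h0
    · simp
    · rw [← neg_div, div_le_iff₀ h0] at hb; linarith
  have hB : 0 ≤ (q + ρ * (1 - q)) := by
    rcases h4.eq_or_lt with h | h
    · rw [← h]; simpa using h0
    · rw [← neg_div, div_le_iff₀ h] at ha; linarith
  have hC : 0 ≤ 1 - ρ := by linarith
  rcases z with ⟨_ | _, _ | _⟩ <;> simp only [pairMass] <;> positivity

instance isFiniteMeasure_pairLaw (q ρ : ℝ) : IsFiniteMeasure (pairLaw q ρ) := by
  constructor
  simp [pairLaw]

theorem isProbabilityMeasure_pairLaw {q ρ : ℝ} (h : Admissible q ρ) :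
    IsProbabilityMeasure (pairLaw q ρ) := by
  constructor
  simp only [pairLaw, Measure.coe_finsetSum, Finset.sum_apply, Measure.smul_apply,
    measure_univ, smul_eq_mul, mul_one]
  rw [← ENNReal.ofReal_sum_of_nonneg fun z _ => pairMass_nonneg h z]
  simp only [Fintype.sum_prod_type, Fintype.sum_bool, pairMass, ENNReal.ofReal_eq_one]
  ring

/-- Both coordinates have success probability `q`, and the covariance is `ρ` times the common
variance `q (1 - q)`. -/
theorem pairMass_moments (q ρ : ℝ) :
    (∑ b, pairMass q ρ (true, b) = q) ∧ (∑ a, pairMass q ρ (a, true) = q) ∧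
      pairMass q ρ (true, true) - q * q = ρ * (q * (1 - q)) := by
  simp only [Fintype.sum_bool, pairMass]
  refine ⟨?_, ?_, ?_⟩ <;> ring

end BrokenSample

/-! Write `v = q(1-q)`. All laws live on finite sets, so everything is a finite weighted sum.

Possibility, growing `d`. The inner product over coordinates of the centred column sums of the `X`s
and of the `Y`s has mean `0` under the null and `d m ρ v` under the alternative, whatever the
injection. Its exact variances and Chebyshev's inequality (`exists_statistic_test`) bound the errors
by multiples of `n/(d m ρ²)`, `1/d` and `1/(d m |ρ| v)`.

Possibility, fixed `d`. When `m = n`, compare the two column sums in one coordinate, with the sign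
of `ρ`. Under the alternative their difference has variance `2 n v (1 - |ρ|)`, which is `o(n v)`;
under the null it is spread over the scale `√(n v)`, since binomial atoms are at most `1/√(n v)`
(`exists_sum_test`).

Impossibility by second moments. In the orthogonal Walsh basis, a matched pair has likelihood ratio
`∑_S ρ^|S| φ_S(x) φ_S(y)`. Averaging over injections and using symmetry gives `E₀ L² ≤ ∏_{S ≠ ∅} (1
- (m/n) ρ^(2|S|))⁻¹` (`second_moment_le`). This stays bounded if `(m/n) ρ²` stays away from `1` with
`d` fixed, or if `ρ² d` stays bounded with `d → ∞`; a bounded second moment excludes strong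
detection.

Impossibility by truncation. If `n d q |ρ|` stays bounded, then for `ρ ≥ 0` no matched pair has a
common success with probability bounded below, and on that event the conditional likelihood ratio is
bounded (`sum_altMass_le_of_truncation`). For `ρ < 0`, admissibility forces `|ρ| ≤ 2q`, and the
product is then at least of order `n` as soon as `ρ² d ≥ 1/2`. -/

namespace BrokenSample

/-! ### Reduction from measures to probability mass functions. -/

/-- The probability mass function of a Bernoulli variable. -/
def bernMass (q : ℝ) (b : Bool) : ℝ := if b then q else 1 - q

/-- The probability mass function of a vector of independent Bernoulli variables. -/
def vecMass {d : ℕ} (q : ℝ) (x : Fin d → Bool) : ℝ := ∏ k, bernMass q (x k)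

/-- The joint probability mass function of two correlated Bernoulli vectors. -/
def vecPairMass {d : ℕ} (q ρ : ℝ) (x y : Fin d → Bool) : ℝ := ∏ k, pairMass q ρ (x k, y k)

/-- The data sets of the Bernoulli model. -/
abbrev Data (d n m : ℕ) : Type := (Fin n → Fin d → Bool) × (Fin m → Fin d → Bool)

/-- The probability mass function of the data under the null hypothesis. -/
def nullMass {d n m : ℕ} (q : ℝ) (z : Data d n m) : ℝ :=
  (∏ j, vecMass q (z.1 j)) * ∏ i, vecMass q (z.2 i)

open Classical in
/-- The probability mass function of the data under the alternative given the injection. -/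
noncomputable def altMassGiven {d n m : ℕ} (q ρ : ℝ) (π : Fin m ↪ Fin n) (z : Data d n m) : ℝ :=
  (∏ i, vecPairMass q ρ (z.1 (π i)) (z.2 i)) *
    ∏ j : {j : Fin n // j ∉ Set.range π}, vecMass q (z.1 j)

/-- The probability mass function of the data under the alternative. -/
noncomputable def altMass {d n m : ℕ} (q ρ : ℝ) (z : Data d n m) : ℝ :=
  (Fintype.card (Fin m ↪ Fin n) : ℝ)⁻¹ * ∑ π : Fin m ↪ Fin n, altMassGiven q ρ π z

theorem bernMass_nonneg {q : ℝ} (h0 : 0 ≤ q) (h1 : q ≤ 1) (b : Bool) : 0 ≤ bernMass q b := by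
  unfold bernMass; split_ifs <;> linarith

theorem sum_bernMass (q : ℝ) : ∑ b, bernMass q b = 1 := by
  simp [bernMass]

theorem sum_pairMass_right (q ρ : ℝ) (a : Bool) :
    ∑ b, pairMass q ρ (a, b) = bernMass q a := by
  cases a <;> simp [bernMass, pairMass] <;> ring

theorem sum_pairMass_left (q ρ : ℝ) (b : Bool) :
    ∑ a, pairMass q ρ (a, b) = bernMass q b := by
  cases b <;> simp [bernMass, pairMass] <;> ring

theorem sum_pairMass (q ρ : ℝ) : ∑ z, pairMass q ρ z = 1 := by
  simp only [Fintype.sum_prod_type, sum_pairMass_right, sum_bernMass]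

theorem vecMass_nonneg {d : ℕ} {q : ℝ} (h0 : 0 ≤ q) (h1 : q ≤ 1) (x : Fin d → Bool) :
    0 ≤ vecMass q x := Finset.prod_nonneg fun _ _ => bernMass_nonneg h0 h1 _

theorem vecPairMass_nonneg {d : ℕ} {q ρ : ℝ} (h : Admissible q ρ) (x y : Fin d → Bool) :
    0 ≤ vecPairMass q ρ x y := Finset.prod_nonneg fun _ _ => pairMass_nonneg h _

theorem sum_vecPairMass_right {d : ℕ} (q ρ : ℝ) (x : Fin d → Bool) :
    ∑ y, vecPairMass q ρ x y = vecMass q x := by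
  simp only [vecPairMass, vecMass, ← sum_pairMass_right q ρ, Fintype.prod_sum]

theorem sum_vecPairMass_left {d : ℕ} (q ρ : ℝ) (y : Fin d → Bool) :
    ∑ x, vecPairMass q ρ x y = vecMass q y := by
  simp only [vecPairMass, vecMass, ← sum_pairMass_left q ρ, Fintype.prod_sum]

theorem nullMass_nonneg {d n m : ℕ} {q : ℝ} (h0 : 0 ≤ q) (h1 : q ≤ 1) (z : Data d n m) :
    0 ≤ nullMass q z :=
  mul_nonneg (Finset.prod_nonneg fun _ _ => vecMass_nonneg h0 h1 _)
    (Finset.prod_nonneg fun _ _ => vecMass_nonneg h0 h1 _)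

theorem altMassGiven_nonneg {d n m : ℕ} {q ρ : ℝ} (h : Admissible q ρ) (π : Fin m ↪ Fin n)
    (z : Data d n m) : 0 ≤ altMassGiven q ρ π z :=
  mul_nonneg (Finset.prod_nonneg fun _ _ => vecPairMass_nonneg h _ _)
    (Finset.prod_nonneg fun _ _ => vecMass_nonneg h.1 h.2.1 _)

theorem altMass_nonneg {d n m : ℕ} {q ρ : ℝ} (h : Admissible q ρ)
    (z : Data d n m) : 0 ≤ altMass q ρ z :=
  mul_nonneg (by positivity) (Finset.sum_nonneg fun _ _ => altMassGiven_nonneg h _ _)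

theorem pairLaw_singleton (q ρ : ℝ) (z : Bool × Bool) :
    pairLaw q ρ {z} = ENNReal.ofReal (pairMass q ρ z) := by
  classical
  simp [pairLaw, Set.indicator_apply]

theorem bernoulliModel_singleton {d : ℕ} {q ρ : ℝ} (h : Admissible q ρ) (x y : Fin d → Bool) :
    bernoulliModel d q ρ {(x, y)} = ENNReal.ofReal (vecPairMass q ρ x y) := by
  have hpre : (fun z : Fin d → Bool × Bool => ((fun j => (z j).1, fun j => (z j).2) :
      (Fin d → Bool) × (Fin d → Bool))) ⁻¹' {(x, y)} = {fun j => (x j, y j)} := by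
    ext z
    simp [Prod.ext_iff, funext_iff, forall_and]
  rw [bernoulliModel, Measure.map_apply (by fun_prop) (measurableSet_singleton _), hpre,
    Measure.pi_singleton, vecPairMass, ENNReal.ofReal_prod_of_nonneg
      (fun _ _ => pairMass_nonneg h _)]
  simp [pairLaw_singleton]

theorem isProbabilityMeasure_bernoulliModel {d : ℕ} {q ρ : ℝ} (h : Admissible q ρ) :
    IsProbabilityMeasure (bernoulliModel d q ρ) := by
  have := isProbabilityMeasure_pairLaw h
  exact Measure.isProbabilityMeasure_map (by fun_prop)

theorem fst_bernoulliModel_singleton {d : ℕ} {q ρ : ℝ} (h : Admissible q ρ) (x : Fin d → Bool) :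
    (bernoulliModel d q ρ).fst {x} = ENNReal.ofReal (vecMass q x) := by
  classical
  have hpre : (Prod.fst ⁻¹' {x} : Set ((Fin d → Bool) × (Fin d → Bool))) =
      ((Finset.univ.image fun y => (x, y) :
        Finset ((Fin d → Bool) × (Fin d → Bool))) : Set _) := by
    ext ⟨a, b⟩; simp [eq_comm]
  rw [Measure.fst_apply (measurableSet_singleton _), hpre, ← sum_measure_singleton,
    Finset.sum_image (Prod.mk_right_injective x).injOn, ← sum_vecPairMass_right q ρ,
    ENNReal.ofReal_sum_of_nonneg fun _ _ => vecPairMass_nonneg h _ _]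
  simp [bernoulliModel_singleton h]

theorem snd_bernoulliModel_singleton {d : ℕ} {q ρ : ℝ} (h : Admissible q ρ) (y : Fin d → Bool) :
    (bernoulliModel d q ρ).snd {y} = ENNReal.ofReal (vecMass q y) := by
  classical
  have hpre : (Prod.snd ⁻¹' {y} : Set ((Fin d → Bool) × (Fin d → Bool))) =
      ((Finset.univ.image fun x => (x, y) :
        Finset ((Fin d → Bool) × (Fin d → Bool))) : Set _) := by
    ext ⟨a, b⟩; simp [eq_comm]
  rw [Measure.snd_apply (measurableSet_singleton _), hpre, ← sum_measure_singleton,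
    Finset.sum_image (Prod.mk_left_injective y).injOn, ← sum_vecPairMass_left q ρ,
    ENNReal.ofReal_sum_of_nonneg fun _ _ => vecPairMass_nonneg h _ _]
  simp [bernoulliModel_singleton h]

theorem nullLaw_singleton {d n m : ℕ} {q ρ : ℝ} (h : Admissible q ρ) (z : Data d n m) :
    nullLaw (bernoulliModel d q ρ) n m {z} = ENNReal.ofReal (nullMass q z) := by
  have := isProbabilityMeasure_bernoulliModel (d := d) h
  have h1 : ∀ x : Fin d → Bool, 0 ≤ vecMass q x := vecMass_nonneg h.1 h.2.1
  rw [nullLaw, nullMass, ENNReal.ofReal_mul (Finset.prod_nonneg fun _ _ => h1 _),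
    ENNReal.ofReal_prod_of_nonneg fun _ _ => h1 _, ENNReal.ofReal_prod_of_nonneg fun _ _ => h1 _,
    show ({z} : Set (Data d n m)) = {z.1} ×ˢ {z.2} by simp, Measure.prod_prod,
    Measure.pi_singleton, Measure.pi_singleton]
  simp [fst_bernoulliModel_singleton h, snd_bernoulliModel_singleton h]

theorem altLawGiven_singleton {d n m : ℕ} {q ρ : ℝ} (h : Admissible q ρ) (π : Fin m ↪ Fin n)
    (z : Data d n m) :
    altLawGiven (bernoulliModel d q ρ) π {z} = ENNReal.ofReal (altMassGiven q ρ π z) := by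
  classical
  have := isProbabilityMeasure_bernoulliModel (d := d) h
  have h1 : ∀ x : Fin d → Bool, 0 ≤ vecMass q x := vecMass_nonneg h.1 h.2.1
  have hpre : (assemble π : _ → Data d n m) ⁻¹' {z} =
      {fun i => (z.1 (π i), z.2 i)} ×ˢ {fun j : {j : Fin n // j ∉ Set.range π} => z.1 j} := by
    ext ⟨a, b⟩
    simp only [Set.mem_preimage, Set.mem_singleton_iff, Set.mem_prod]
    constructor
    · rintro rfl
      refine ⟨funext fun i => ?_, funext fun j => ?_⟩
      · have hi : π i ∈ Set.range π := ⟨i, rfl⟩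
        have h2 : hi.choose = i := π.injective hi.choose_spec
        simp only [assemble, hi, dite_true, h2]
      · simp only [assemble, j.2, dite_false]
    · rintro ⟨rfl, rfl⟩
      refine Prod.ext (funext fun j => ?_) (funext fun i => ?_)
      · by_cases hj : j ∈ Set.range π
        · simp only [assemble, hj, dite_true, hj.choose_spec]
        · simp only [assemble, hj, dite_false]
      · simp only [assemble]
  rw [altLawGiven, Measure.map_apply (measurable_assemble π) (measurableSet_singleton _), hpre,
    Measure.prod_prod, Measure.pi_singleton, Measure.pi_singleton, altMassGiven,
    ENNReal.ofReal_mul (Finset.prod_nonneg fun _ _ => vecPairMass_nonneg h _ _),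
    ENNReal.ofReal_prod_of_nonneg fun _ _ => h1 _,
    ENNReal.ofReal_prod_of_nonneg fun _ _ => vecPairMass_nonneg h _ _]
  simp only [fst_bernoulliModel_singleton h, bernoulliModel_singleton h]

theorem nullLaw_finset {d n m : ℕ} {q ρ : ℝ} (h : Admissible q ρ) (T : Finset (Data d n m)) :
    nullLaw (bernoulliModel d q ρ) n m T = ENNReal.ofReal (∑ z ∈ T, nullMass q z) := by
  rw [← sum_measure_singleton,
    ENNReal.ofReal_sum_of_nonneg fun _ _ => nullMass_nonneg h.1 h.2.1 _]
  simp [nullLaw_singleton h]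

theorem altLaw_finset {d n m : ℕ} {q ρ : ℝ} (h : Admissible q ρ) (hmn : m ≤ n)
    (T : Finset (Data d n m)) :
    altLaw (bernoulliModel d q ρ) n m T = ENNReal.ofReal (∑ z ∈ T, altMass q ρ z) := by
  have hne : Nonempty (Fin m ↪ Fin n) := ⟨Fin.castLEEmb hmn⟩
  have hc : 0 < (Fintype.card (Fin m ↪ Fin n) : ℝ) := by exact_mod_cast Fintype.card_pos
  rw [← sum_measure_singleton, ENNReal.ofReal_sum_of_nonneg fun _ _ => altMass_nonneg h _]
  refine Finset.sum_congr rfl fun z _ => ?_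
  rw [altMass, ENNReal.ofReal_mul (by positivity),
    ENNReal.ofReal_sum_of_nonneg fun _ _ => altMassGiven_nonneg h _ _,
    ENNReal.ofReal_inv_of_pos hc, ENNReal.ofReal_natCast]
  simp only [altLaw, Measure.smul_apply, Measure.coe_finsetSum, Finset.sum_apply, smul_eq_mul,
    altLawGiven_singleton h]

/-- Strong detection means that, for every level, both error probabilities are eventually below
that level for a suitable test. -/
theorem strongDetection_iff {d n m : ℕ → ℕ} {q ρ : ℕ → ℝ} (h : ∀ k, Admissible (q k) (ρ k))
    (hmn : ∀ k, m k ≤ n k) :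
    StrongDetection (fun k => bernoulliModel (d k) (q k) (ρ k)) n m ↔
      ∀ δ : ℝ, 0 < δ → ∀ᶠ k in atTop, ∃ T : Finset (Data (d k) (n k) (m k)),
        ∑ z ∈ T, nullMass (q k) z < δ ∧ ∑ z ∈ Tᶜ, altMass (q k) (ρ k) z < δ := by
  classical
  constructor
  · rintro ⟨T, -, h1, h2⟩ δ hδ
    have hδ' : (0 : ℝ≥0∞) < ENNReal.ofReal δ := by simpa
    filter_upwards [h1.eventually_lt_const hδ', h2.eventually_lt_const hδ'] with k hk1 hk2
    refine ⟨(T k).toFinset, ?_, ?_⟩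
    · have := nullLaw_finset (h k) (T k).toFinset
      rw [Set.coe_toFinset] at this
      rw [this] at hk1
      exact (ENNReal.ofReal_lt_ofReal_iff hδ).1 hk1
    · have := altLaw_finset (h k) (hmn k) (T k).toFinsetᶜ
      rw [Finset.coe_compl, Set.coe_toFinset] at this
      rw [this] at hk2
      exact (ENNReal.ofReal_lt_ofReal_iff hδ).1 hk2
  · intro H
    have hN : ∀ k (T : Finset (Data (d k) (n k) (m k))), 0 ≤ ∑ z ∈ T, nullMass (q k) z :=
      fun k T => Finset.sum_nonneg fun _ _ => nullMass_nonneg (h k).1 (h k).2.1 _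
    have hA : ∀ k (T : Finset (Data (d k) (n k) (m k))), 0 ≤ ∑ z ∈ T, altMass (q k) (ρ k) z :=
      fun k T => Finset.sum_nonneg fun _ _ => altMass_nonneg (h k) _
    -- There are finitely many tests for each `k`; one minimizing the total error does at least as
    -- well as the test supplied for any level, so a single sequence serves all levels.
    choose T hT using fun k => Finite.exists_min fun T : Finset (Data (d k) (n k) (m k)) =>
      ∑ z ∈ T, nullMass (q k) z + ∑ z ∈ Tᶜ, altMass (q k) (ρ k) z
    have key : ∀ δ : ℝ, 0 < δ → ∀ᶠ k in atTop,
        ∑ z ∈ T k, nullMass (q k) z + ∑ z ∈ (T k)ᶜ, altMass (q k) (ρ k) z < δ := by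
      intro δ hδ
      filter_upwards [H (δ / 2) (by positivity)] with k ⟨S, hS1, hS2⟩
      linarith [hT k S]
    have lim : Tendsto (fun k => ∑ z ∈ T k, nullMass (q k) z +
        ∑ z ∈ (T k)ᶜ, altMass (q k) (ρ k) z) atTop (𝓝 0) := by
      rw [Metric.tendsto_atTop']
      intro ε hε
      obtain ⟨N, hN'⟩ := eventually_atTop.1 (key ε hε)
      refine ⟨N, fun k hk => ?_⟩
      rw [Real.dist_0_eq_abs, abs_of_nonneg (add_nonneg (hN k _) (hA k _))]
      exact hN' k hk.le
    refine ⟨fun k => T k, fun k => (T k).measurableSet, ?_, ?_⟩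
    · simp only [nullLaw_finset (h _)]
      rw [← ENNReal.ofReal_zero]
      exact ENNReal.tendsto_ofReal (squeeze_zero (fun k => hN k _)
        (fun k => le_add_of_nonneg_right (hA k _)) lim)
    · simp only [← Finset.coe_compl, altLaw_finset (h _) (hmn _)]
      rw [← ENNReal.ofReal_zero]
      exact ENNReal.tendsto_ofReal (squeeze_zero (fun k => hA k _)
        (fun k => le_add_of_nonneg_left (hN k _)) lim)

/-! ### Counting injections that carry given labels. -/

section Injections

variable {n m : ℕ}

open Classical in
/-- The number of injections whose range contains a given set. -/
noncomputable def coverCount (m : ℕ) {n : ℕ} (S : Finset (Fin n)) : ℕ :=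
  Finset.card {π : Fin m ↪ Fin n | ∀ j ∈ S, j ∈ Set.range π}

theorem coverCount_insert_eq {S : Finset (Fin n)} {j j' : Fin n} (hj : j ∉ S) (hj' : j' ∉ S) :
    coverCount m (insert j S) = coverCount m (insert j' S) := by
  classical
  refine Finset.card_equiv (Equiv.embeddingCongr (Equiv.refl _) (Equiv.swap j j')) fun π => ?_
  have hS : ∀ i ∈ S, Equiv.swap j j' i = i := fun i hi =>
    Equiv.swap_apply_of_ne_of_ne (fun h => hj (h ▸ hi)) (fun h => hj' (h ▸ hi))
  have hr : ∀ i, i ∈ Set.range π ↔ Equiv.swap j j' i ∈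
      Set.range (Equiv.embeddingCongr (Equiv.refl (Fin m)) (Equiv.swap j j') π) := fun i => by
    simp [Equiv.embeddingCongr]
  simp only [Finset.mem_filter, Finset.mem_univ, true_and, Finset.forall_mem_insert]
  refine and_congr ?_ (forall₂_congr fun i hi => ?_)
  · rw [hr j, Equiv.swap_apply_left]
  · rw [hr i, hS i hi]

/-- Double counting: an injection covering `S` has `m - |S|` further points in its range. The
truncated subtraction is harmless, since nothing covers `S` when `|S| > m`. -/
theorem sum_coverCount_insert (S : Finset (Fin n)) :
    ∑ j ∈ Sᶜ, coverCount m (insert j S) = (m - S.card) * coverCount m S := by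
  classical
  have h1 : ∀ j, coverCount m (insert j S) =
      ∑ π ∈ ({π : Fin m ↪ Fin n | ∀ j ∈ S, j ∈ Set.range π} : Finset _),
        if j ∈ Set.range π then 1 else 0 := fun j => by
    rw [coverCount, Finset.card_filter, Finset.sum_filter]
    refine Finset.sum_congr rfl fun π _ => ?_
    rw [← ite_and]
    congr 1
    simp only [Finset.forall_mem_insert, and_comm]
  simp only [h1]
  rw [Finset.sum_comm, mul_comm, coverCount, ← smul_eq_mul, ← Finset.sum_const]
  refine Finset.sum_congr rfl fun π hπ => ?_
  simp only [Finset.mem_filter, Finset.mem_univ, true_and] at hπ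
  rw [← Finset.card_filter]
  have h2 : Finset.filter (fun j => j ∈ Set.range π) Sᶜ = Finset.univ.map π \ S := by
    ext j; simp [and_comm]
  have h3 : S ⊆ Finset.univ.map π := fun j hj => by simpa using hπ j hj
  rw [h2, Finset.card_sdiff_of_subset h3]
  simp

/-- The range of a random injection contains `S` with probability at most `(m/n)^|S|`: by symmetry
each new point costs a factor `(m - s)/(n - s) ≤ m/n`. -/
theorem coverCount_mul_le (hmn : m ≤ n) (S : Finset (Fin n)) :
    (coverCount m S : ℝ) * n ^ S.card ≤ m ^ S.card * Fintype.card (Fin m ↪ Fin n) := by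
  classical
  induction S using Finset.induction_on with
  | empty => simp [coverCount]
  | insert j S hj ih =>
    have hcard : S.card < n := by
      have := Finset.card_lt_univ_of_notMem hj
      simpa using this
    have h1 : (n - S.card) * coverCount m (insert j S) = (m - S.card) * coverCount m S := by
      rw [← sum_coverCount_insert, Finset.sum_congr rfl fun i hi =>
        coverCount_insert_eq (m := m) (Finset.mem_compl.1 hi) hj]
      simp [Finset.card_compl]
    have h2 : n * coverCount m (insert j S) ≤ m * coverCount m S := by
      have h3 : (m - S.card) * n ≤ m * (n - S.card) := by
        rcases le_total m S.card with h | h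
        · simp [Nat.sub_eq_zero_of_le h]
        · zify [h, hcard.le]
          have : (S.card : ℤ) * m ≤ S.card * n := by gcongr
          linarith
      refine Nat.le_of_mul_le_mul_left (c := n - S.card) ?_ (by omega)
      calc (n - S.card) * (n * coverCount m (insert j S))
          = n * ((n - S.card) * coverCount m (insert j S)) := by ring
        _ = (m - S.card) * n * coverCount m S := by rw [h1]; ring
        _ ≤ m * (n - S.card) * coverCount m S := by gcongr
        _ = (n - S.card) * (m * coverCount m S) := by ring
    have h2' : (n : ℝ) * coverCount m (insert j S) ≤ m * coverCount m S := by exact_mod_cast h2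
    rw [Finset.card_insert_of_notMem hj]
    calc (coverCount m (insert j S) : ℝ) * n ^ (S.card + 1)
        = n * coverCount m (insert j S) * n ^ S.card := by ring
      _ ≤ m * coverCount m S * n ^ S.card := by gcongr
      _ = m * (coverCount m S * n ^ S.card) := by ring
      _ ≤ m * (m ^ S.card * Fintype.card (Fin m ↪ Fin n)) := by gcongr
      _ = _ := by ring

variable {A : Type*}

/-- Move labels along an injection, with the label `o` outside its range. -/
noncomputable def pushLabel (o : A) (π : Fin m ↪ Fin n) (a : Fin m → A) : Fin n → A :=
  Function.extend π a fun _ => o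

@[simp]
theorem pushLabel_apply (o : A) (π : Fin m ↪ Fin n) (a : Fin m → A) (i : Fin m) :
    pushLabel o π a (π i) = a i := π.injective.extend_apply _ _ _

theorem pushLabel_of_notMem (o : A) (π : Fin m ↪ Fin n) (a : Fin m → A) {j : Fin n}
    (hj : j ∉ Set.range π) : pushLabel o π a j = o :=
  Function.extend_apply' _ _ _ fun ⟨i, hi⟩ => hj ⟨i, hi⟩

theorem prod_pushLabel (o : A) (π : Fin m ↪ Fin n) (a : Fin m → A) (G : Fin n → A → ℝ)
    (hG : ∀ j, G j o = 1) : ∏ j, G j (pushLabel o π a j) = ∏ i, G (π i) (a i) := by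
  classical
  rw [← Finset.prod_subset (Finset.subset_univ (Finset.univ.map π)), Finset.prod_map]
  · simp
  · intro j _ hj
    rw [pushLabel_of_notMem _ _ _ (by simpa using hj), hG]

theorem pushLabel_trans_perm (o : A) (π : Fin m ↪ Fin n) (a : Fin m → A)
    (σ : Equiv.Perm (Fin n)) :
    pushLabel o (Equiv.embeddingCongr (Equiv.refl _) σ π) a ∘ σ = pushLabel o π a := by
  funext j
  by_cases hj : j ∈ Set.range π
  · obtain ⟨i, rfl⟩ := hj
    have : σ (π i) = Equiv.embeddingCongr (Equiv.refl _) σ π i := by simp [Equiv.embeddingCongr]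
    rw [Function.comp_apply, this, pushLabel_apply, pushLabel_apply]
  · rw [Function.comp_apply, pushLabel_of_notMem _ _ _ hj, pushLabel_of_notMem]
    simpa [Equiv.embeddingCongr] using hj

variable [DecidableEq A]

/-- The probability that a uniformly random injection moves the labels `a` to `b`. -/
noncomputable def transfer (o : A) (a : Fin m → A) (b : Fin n → A) : ℝ :=
  (Fintype.card (Fin m ↪ Fin n) : ℝ)⁻¹ *
    (Finset.card {π : Fin m ↪ Fin n | pushLabel o π a = b} : ℝ)

theorem transfer_nonneg (o : A) (a : Fin m → A) (b : Fin n → A) : 0 ≤ transfer o a b := by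
  unfold transfer; positivity

theorem transfer_comp_perm (o : A) (a : Fin m → A) (b : Fin n → A) (σ : Equiv.Perm (Fin n)) :
    transfer o a (b ∘ σ) = transfer o a b := by
  unfold transfer
  congr 2
  refine Finset.card_equiv (Equiv.embeddingCongr (Equiv.refl _) σ) fun π => ?_
  simp only [Finset.mem_filter, Finset.mem_univ, true_and]
  rw [← pushLabel_trans_perm o π a σ]
  exact σ.surjective.injective_comp_right.eq_iff

variable [Fintype A]

theorem sum_transfer_left_le (o : A) (a : Fin m → A) :
    ∑ b : Fin n → A, transfer o a b ≤ 1 := by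
  classical
  unfold transfer
  rw [← Finset.mul_sum, ← Nat.cast_sum]
  have h := Finset.card_eq_sum_card_fiberwise (s := (Finset.univ : Finset (Fin m ↪ Fin n)))
    (t := Finset.univ) (f := fun π => pushLabel o π a) (fun _ _ => Finset.mem_coe.2 (Finset.mem_univ _))
  rw [← h, Finset.card_univ]
  exact inv_mul_le_one

/-- For a given injection at most one labelling `a` is carried to `b`, and only if the range covers
all points where `b` differs from `o`. -/
theorem sum_transfer_right_le (hmn : m ≤ n) (hn : 0 < n) (o : A) (b : Fin n → A) :
    ∑ a : Fin m → A, transfer o a b ≤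
      ((m : ℝ) / n) ^ (Finset.card {j | b j ≠ o}) := by
  classical
  have hne : Nonempty (Fin m ↪ Fin n) := ⟨Fin.castLEEmb hmn⟩
  have hc : 0 < (Fintype.card (Fin m ↪ Fin n) : ℝ) := by exact_mod_cast Fintype.card_pos
  have hn' : (0 : ℝ) < n := by exact_mod_cast hn
  set S : Finset (Fin n) := {j | b j ≠ o} with hS
  have h1 : ∑ a : Fin m → A, Finset.card {π : Fin m ↪ Fin n | pushLabel o π a = b} ≤
      coverCount m S := by
    simp only [Finset.card_filter, coverCount]
    rw [Finset.sum_comm]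
    refine Finset.sum_le_sum fun π _ => ?_
    rw [← Finset.card_filter]
    split_ifs with h
    · refine Finset.card_le_one.2 fun a ha a' ha' => ?_
      simp only [Finset.mem_filter, Finset.mem_univ, true_and] at ha ha'
      funext i
      rw [← pushLabel_apply o π a i, ← pushLabel_apply o π a' i, ha, ha']
    · refine (Finset.card_eq_zero.2 (Finset.filter_eq_empty_iff.2 fun a _ ha => h ?_)).le
      intro j hj
      by_contra hj'
      rw [hS, Finset.mem_filter, ← ha] at hj
      exact hj.2 (pushLabel_of_notMem _ _ _ hj')
  have h2 := coverCount_mul_le hmn S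
  unfold transfer
  rw [← Finset.mul_sum, ← Nat.cast_sum, div_pow, inv_mul_le_iff₀ hc, mul_div_assoc',
    le_div_iff₀ (by positivity)]
  calc _ ≤ (coverCount m S : ℝ) * n ^ S.card := by gcongr
    _ ≤ _ := by linarith

/-- The number of occurrences of each label different from `o`. -/
def labelType (o : A) (b : Fin n → A) : {a : A // a ≠ o} → ℕ :=
  fun a => Finset.card {j | b j = a}

/-- The count of the omitted label `o` is recovered from the total `n`, so equal types mean equal
fibre sizes for every label. -/
theorem exists_perm_of_labelType_eq {o : A} {b b' : Fin n → A}
    (h : labelType o b' = labelType o b) : ∃ σ : Equiv.Perm (Fin n), b' = b ∘ σ := by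
  have h1 : ∀ c, c ≠ o → Finset.card {j | b' j = c} = Finset.card {j | b j = c} :=
    fun c hc => congrFun h ⟨c, hc⟩
  have hs : ∀ f : Fin n → A, Finset.card {j | f j = o} +
      ∑ c ∈ Finset.univ.erase o, Finset.card {j | f j = c} = n := fun f => by
    rw [Finset.add_sum_erase _ (fun c => Finset.card {j | f j = c}) (Finset.mem_univ o)]
    have := Finset.card_eq_sum_card_fiberwise (s := (Finset.univ : Finset (Fin n)))
      (t := Finset.univ) (f := f) (fun _ _ => Finset.mem_coe.2 (Finset.mem_univ _))
    rw [← this]; simp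
  have h2 : ∀ c, Finset.card {j | b' j = c} = Finset.card {j | b j = c} := fun c => by
    by_cases hc : c = o
    · subst hc
      have h3 := hs b
      have h4 := hs b'
      rw [Finset.sum_congr rfl fun a ha => h1 a (Finset.ne_of_mem_erase ha)] at h4
      omega
    · exact h1 c hc
  have e : ∀ c, Nonempty ({j // b' j = c} ≃ {j // b j = c}) := fun c => by
    rw [← Fintype.card_eq, Fintype.card_subtype, Fintype.card_subtype, h2]
  exact ⟨Equiv.ofFiberEquiv fun c => (e c).some,
    funext fun j => (Equiv.ofFiberEquiv_map (fun c => (e c).some) j).symm⟩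

/-- All rearrangements of `b` are equally likely images of `a`, and their probabilities add up to at
most `1`. -/
theorem transfer_mul_card_le (o : A) (a : Fin m → A) (b : Fin n → A) :
    transfer o a b * (Finset.card {b' : Fin n → A | labelType o b' = labelType o b} : ℝ) ≤ 1 := by
  rw [mul_comm, ← nsmul_eq_mul, ← Finset.sum_const]
  refine le_trans ?_ (sum_transfer_left_le (n := n) o a)
  rw [Finset.sum_congr (g := fun b' => transfer o a b') rfl]
  · exact Finset.sum_le_univ_sum_of_nonneg fun _ => transfer_nonneg _ _ _
  · intro b' hb'
    obtain ⟨σ, rfl⟩ := exists_perm_of_labelType_eq (Finset.mem_filter.1 hb').2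
    exact (transfer_comp_perm o a b σ).symm

/-- Dividing by the orbit size makes each label type count once; the sum over types is then
dominated by a product of geometric series, one for each label other than `o`. -/
theorem sum_prod_div_card_le (o : A) (μ : A → ℝ) (hμo : μ o = 1) (hμ0 : ∀ a, 0 ≤ μ a)
    (hμ1 : ∀ a, a ≠ o → μ a < 1) :
    ∑ b : Fin n → A, (∏ j, μ (b j)) /
      (Finset.card {b' : Fin n → A | labelType o b' = labelType o b} : ℝ) ≤
      ∏ a : {a // a ≠ o}, (1 - μ a)⁻¹ := by
  classical
  have h1 : ∀ b : Fin n → A, ∏ j, μ (b j) = ∏ a : {a // a ≠ o}, μ a ^ labelType o b a := by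
    intro b
    rw [Finset.prod_comp μ b, Finset.prod_subset (Finset.subset_univ _)
      (fun c _ hc => ?_), ← Finset.mul_prod_erase _ _ (Finset.mem_univ o), hμo, one_pow, one_mul]
    · rw [Finset.prod_subtype (p := fun a => a ≠ o) _ (by simp)]
      rfl
    · rw [Finset.filter_eq_empty_iff.2, Finset.card_empty, pow_zero]
      rintro j - rfl
      exact hc (Finset.mem_image_of_mem _ (Finset.mem_univ _))
  let F : ({a // a ≠ o} → ℕ) → ℝ := fun t => ∏ a : {a // a ≠ o}, μ a ^ t a
  let K : ({a // a ≠ o} → ℕ) → ℝ := fun t =>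
    (Finset.card {b' : Fin n → A | labelType o b' = t} : ℝ)
  have hF : ∀ t, 0 ≤ F t := fun t => Finset.prod_nonneg fun a _ => pow_nonneg (hμ0 a) _
  calc _ = ∑ b : Fin n → A, F (labelType o b) / K (labelType o b) :=
        Finset.sum_congr rfl fun b _ => by rw [h1 b]
    _ = ∑ t ∈ Finset.univ.image (labelType o), (Finset.card {b' : Fin n → A |
          labelType o b' = t}) • (F t / K t) :=
        Finset.sum_comp (fun t => F t / K t) (labelType o)
    _ ≤ ∑ t ∈ Finset.univ.image (labelType (n := n) o), F t := by
        refine Finset.sum_le_sum fun t _ => ?_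
        rw [nsmul_eq_mul]
        rcases eq_or_ne (K t) 0 with h | h
        · simpa [h] using hF t
        · exact (mul_div_cancel₀ (F t) h).le
    _ ≤ ∑ t ∈ Fintype.piFinset fun _ : {a // a ≠ o} => Finset.range (n + 1), F t := by
        refine Finset.sum_le_sum_of_subset_of_nonneg ?_ fun t _ _ => hF t
        intro t ht
        obtain ⟨b, -, rfl⟩ := Finset.mem_image.1 ht
        refine Fintype.mem_piFinset.2 fun a => Finset.mem_range_succ_iff.2 ?_
        exact (Finset.card_le_univ _).trans_eq (Fintype.card_fin n)
    _ = ∏ a : {a // a ≠ o}, ∑ i ∈ Finset.range (n + 1), μ a ^ i :=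
        (Finset.prod_univ_sum _ _).symm
    _ ≤ _ := by
        refine Finset.prod_le_prod (fun a _ => Finset.sum_nonneg fun i _ => pow_nonneg (hμ0 a) _)
          fun a _ => ?_
        rw [← tsum_geometric_of_lt_one (hμ0 a) (hμ1 a a.2)]
        exact (summable_geometric_of_lt_one (hμ0 a) (hμ1 a a.2)).sum_le_tsum _
          fun i _ => pow_nonneg (hμ0 a) _

/-- Of the two factors in `transfer ^ 2`, one is bounded by the inverse orbit size and the other is
summed over `a`, which yields the powers of `m/n`. -/
theorem sum_sq_transfer_le (hmn : m ≤ n) (hn : 0 < n) (o : A) (l : A → ℝ) (hlo : l o = 1)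
    (hl : ∀ a, a ≠ o → (m : ℝ) / n * l a ^ 2 < 1) :
    ∑ b : Fin n → A, ∑ a : Fin m → A, ((∏ j, l (b j)) * transfer o a b) ^ 2 ≤
      ∏ a : {a // a ≠ o}, (1 - (m : ℝ) / n * l a ^ 2)⁻¹ := by
  classical
  let μ : A → ℝ := fun a => if a = o then 1 else (m : ℝ) / n * l a ^ 2
  have hμ : ∀ a, a ≠ o → μ a = (m : ℝ) / n * l a ^ 2 := fun a ha => if_neg ha
  have h0 : ∀ a, 0 ≤ μ a := fun a => by simp only [μ]; split_ifs <;> positivity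
  have h1 := sum_prod_div_card_le (n := n) o μ (if_pos rfl) h0 fun a ha => (hμ a ha) ▸ hl a ha
  have h2 : ∏ a : {a // a ≠ o}, (1 - (m : ℝ) / n * l a ^ 2)⁻¹ =
      ∏ a : {a // a ≠ o}, (1 - μ a)⁻¹ :=
    Finset.prod_congr rfl fun a _ => by rw [hμ a a.2]
  rw [h2]
  refine le_trans (Finset.sum_le_sum fun b _ => ?_) h1
  set K : ℝ := (Finset.card {b' : Fin n → A | labelType o b' = labelType o b} : ℝ)
  have hK : 0 < K := by
    refine Nat.cast_pos.2 (Finset.card_pos.2 ⟨b, by simp⟩)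
  have hprod : ∏ j, μ (b j) =
      (∏ j, l (b j)) ^ 2 * ((m : ℝ) / n) ^ (Finset.card {j | b j ≠ o}) := by
    rw [← Finset.prod_pow, ← Finset.prod_const, Finset.prod_filter, ← Finset.prod_mul_distrib]
    refine Finset.prod_congr rfl fun j _ => ?_
    by_cases hj : b j = o
    · simp [μ, hj, hlo]
    · simp [μ, hj, mul_comm]
  calc ∑ a : Fin m → A, ((∏ j, l (b j)) * transfer o a b) ^ 2
      ≤ ∑ a : Fin m → A, (∏ j, l (b j)) ^ 2 * (transfer o a b * K⁻¹) := by
        refine Finset.sum_le_sum fun a _ => ?_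
        have := transfer_mul_card_le o a b
        rw [mul_pow, sq (transfer o a b)]
        have h3 : transfer o a b ≤ K⁻¹ := by rwa [← one_div, le_div_iff₀ hK]
        have h4 := transfer_nonneg o a b
        gcongr
    _ = (∏ j, l (b j)) ^ 2 * (∑ a : Fin m → A, transfer o a b) / K := by
        rw [div_eq_mul_inv, ← Finset.mul_sum, ← Finset.sum_mul, mul_assoc]
    _ ≤ (∏ j, μ (b j)) / K := by
        rw [hprod]
        have := sum_transfer_right_le hmn hn o b
        gcongr

end Injections

/-! ### Second moment of a likelihood ratio averaged over injections. -/

section SecondMoment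

theorem sum_mul_sq_sum_le {Ω τ : Type*} [Fintype Ω] [Fintype τ]
    (w : Ω → ℝ) (ψ : τ → Ω → ℝ) (c : τ → ℝ)
    (horth : ∀ s t, s ≠ t → ∑ ω, w ω * (ψ s ω * ψ t ω) = 0)
    (hnorm : ∀ t, ∑ ω, w ω * (ψ t ω * ψ t ω) ≤ 1) :
    ∑ ω, w ω * (∑ t, c t * ψ t ω) ^ 2 ≤ ∑ t, c t ^ 2 := by
  classical
  have h1 : ∀ ω, w ω * (∑ t, c t * ψ t ω) ^ 2 =
      ∑ s, ∑ t, c s * c t * (w ω * (ψ s ω * ψ t ω)) := fun ω => by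
    rw [sq, Finset.sum_mul_sum, Finset.mul_sum]
    refine Finset.sum_congr rfl fun s _ => ?_
    rw [Finset.mul_sum]
    exact Finset.sum_congr rfl fun t _ => by ring
  simp only [h1]
  rw [Finset.sum_comm]
  refine Finset.sum_le_sum fun s _ => ?_
  rw [Finset.sum_comm]
  simp only [← Finset.mul_sum]
  rw [Finset.sum_eq_single s (fun t _ ht => by rw [horth s t ht.symm, mul_zero]) (by simp)]
  nlinarith [sq_nonneg (c s), hnorm s]

/-- Multiplying out over `i` assigns a label to every matched pair. Collecting the injections that
place the labels identically gives an expansion in orthogonal products with coefficients `(∏ l) *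
transfer`, so Bessel's inequality reduces the claim to `sum_sq_transfer_le`. Norms are only assumed
at most `1`, which admits basis functions that vanish in degenerate cases. -/
theorem second_moment_le {n m : ℕ} {A X : Type*} [Fintype A] [DecidableEq A] [Fintype X]
    (hmn : m ≤ n) (hn : 0 < n) (o : A) (p : X → ℝ) (hp : ∀ x, 0 ≤ p x)
    (φ : A → X → ℝ) (l : A → ℝ) (hφo : ∀ x, φ o x = 1) (hlo : l o = 1)
    (hl : ∀ a, a ≠ o → (m : ℝ) / n * l a ^ 2 < 1)
    (horth : ∀ a b, a ≠ b → ∑ x, p x * (φ a x * φ b x) = 0)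
    (hnorm : ∀ a, ∑ x, p x * (φ a x * φ a x) ≤ 1) :
    ∑ z : (Fin n → X) × (Fin m → X), ((∏ j, p (z.1 j)) * ∏ i, p (z.2 i)) *
      ((Fintype.card (Fin m ↪ Fin n) : ℝ)⁻¹ * ∑ π : Fin m ↪ Fin n,
        ∏ i, ∑ a, l a * (φ a (z.1 (π i)) * φ a (z.2 i))) ^ 2 ≤
      ∏ a : {a // a ≠ o}, (1 - (m : ℝ) / n * l a ^ 2)⁻¹ := by
  classical
  let Φ : ∀ {N : ℕ}, (Fin N → A) → (Fin N → X) → ℝ := fun b x => ∏ j, φ (b j) (x j)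
  have hΦ : ∀ {N : ℕ} (b b' : Fin N → A), ∑ x : Fin N → X, (∏ j, p (x j)) * (Φ b x * Φ b' x) =
      ∏ j, ∑ x, p x * (φ (b j) x * φ (b' j) x) := fun b b' => by
    simp only [Φ, ← Finset.prod_mul_distrib, Fintype.prod_sum]
  have hΦ0 : ∀ {N : ℕ} (b b' : Fin N → A), b ≠ b' →
      ∑ x : Fin N → X, (∏ j, p (x j)) * (Φ b x * Φ b' x) = 0 := fun b b' hb => by
    obtain ⟨j, hj⟩ := Function.ne_iff.1 hb
    rw [hΦ]
    exact Finset.prod_eq_zero (Finset.mem_univ j) (horth _ _ hj)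
  have hnn : ∀ a, 0 ≤ ∑ x, p x * (φ a x * φ a x) := fun a =>
    Finset.sum_nonneg fun x _ => mul_nonneg (hp x) (mul_self_nonneg _)
  have hΦn : ∀ {N : ℕ} (b : Fin N → A), 0 ≤ ∑ x : Fin N → X, (∏ j, p (x j)) * (Φ b x * Φ b x) ∧
      ∑ x : Fin N → X, (∏ j, p (x j)) * (Φ b x * Φ b x) ≤ 1 := fun b => by
    rw [hΦ]
    exact ⟨Finset.prod_nonneg fun j _ => hnn _,
      Finset.prod_le_one (fun j _ => hnn _) fun j _ => hnorm _⟩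
  let ψ : (Fin n → A) × (Fin m → A) → (Fin n → X) × (Fin m → X) → ℝ :=
    fun t z => Φ t.1 z.1 * Φ t.2 z.2
  let c : (Fin n → A) × (Fin m → A) → ℝ := fun t => (∏ j, l (t.1 j)) * transfer o t.2 t.1
  have hψ : ∀ s t, ∑ z : (Fin n → X) × (Fin m → X), ((∏ j, p (z.1 j)) * ∏ i, p (z.2 i)) *
      (ψ s z * ψ t z) = (∑ x : Fin n → X, (∏ j, p (x j)) * (Φ s.1 x * Φ t.1 x)) *
        ∑ y : Fin m → X, (∏ i, p (y i)) * (Φ s.2 y * Φ t.2 y) := fun s t => by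
    rw [Finset.sum_mul_sum, Fintype.sum_prod_type]
    refine Finset.sum_congr rfl fun x _ => Finset.sum_congr rfl fun y _ => ?_
    simp only [ψ]
    ring
  have hexp : ∀ z : (Fin n → X) × (Fin m → X),
      (Fintype.card (Fin m ↪ Fin n) : ℝ)⁻¹ * ∑ π : Fin m ↪ Fin n,
        ∏ i, ∑ a, l a * (φ a (z.1 (π i)) * φ a (z.2 i)) = ∑ t, c t * ψ t z := fun z => by
    have h1 : ∀ π : Fin m ↪ Fin n, ∏ i, ∑ a, l a * (φ a (z.1 (π i)) * φ a (z.2 i)) =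
        ∑ a : Fin m → A, ∑ b : Fin n → A,
          if pushLabel o π a = b then (∏ j, l (b j)) * (Φ b z.1 * Φ a z.2) else 0 := fun π => by
      rw [Fintype.prod_sum]
      refine Finset.sum_congr rfl fun a _ => ?_
      rw [Finset.sum_ite_eq, if_pos (Finset.mem_univ _),
        prod_pushLabel o π a (fun _ => l) (fun _ => hlo)]
      simp only [Φ]
      rw [prod_pushLabel o π a (fun j a => φ a (z.1 j)) (fun _ => hφo _),
        ← Finset.prod_mul_distrib, ← Finset.prod_mul_distrib]
    simp only [h1]
    rw [Finset.sum_comm, Fintype.sum_prod_type_right, Finset.mul_sum]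
    refine Finset.sum_congr rfl fun a _ => ?_
    rw [Finset.sum_comm, Finset.mul_sum]
    refine Finset.sum_congr rfl fun b _ => ?_
    rw [← Finset.sum_filter, Finset.sum_const, nsmul_eq_mul]
    simp only [c, ψ, transfer]
    ring
  simp only [hexp]
  refine (sum_mul_sq_sum_le _ ψ c (fun s t hst => ?_) (fun t => ?_)).trans ?_
  · rw [hψ]
    by_cases h : s.1 = t.1
    · rw [hΦ0 s.2 t.2 (fun h' => hst (Prod.ext h h')), mul_zero]
    · rw [hΦ0 _ _ h, zero_mul]
  · rw [hψ]
    exact mul_le_one₀ (hΦn _).2 (hΦn _).1 (hΦn _).2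
  · rw [Fintype.sum_prod_type]
    exact sum_sq_transfer_le hmn hn o l hlo hl

end SecondMoment

/-! ### The alternative as an image of `n` independent pairs per coordinate. -/

section Observe

variable {d n m : ℕ}

/-- The data set obtained by pairing every `Xⱼ` with a `Y` and forgetting the `Y`s outside the
range of the injection; the first index of `ω` is the coordinate. -/
def observe (π : Fin m ↪ Fin n) (ω : Fin d → Fin n → Bool × Bool) : Data d n m :=
  (fun j k => (ω k j).1, fun i k => (ω k (π i)).2)

theorem prod_injection_mul_prod_compl (π : Fin m ↪ Fin n)
    [Fintype {j : Fin n // j ∉ Set.range π}] (f : Fin n → ℝ) :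
    (∏ i, f (π i)) * ∏ j : {j : Fin n // j ∉ Set.range π}, f j = ∏ j, f j := by
  classical
  rw [← Fintype.prod_subtype_mul_prod_subtype (fun j => j ∈ Set.range π) f]
  congr 1
  · convert (Equiv.ofInjective π π.injective).prod_comp (fun j => f j)
    rfl
  · congr!

theorem altMassGiven_eq_sum (q ρ : ℝ) (π : Fin m ↪ Fin n) (z : Data d n m) :
    altMassGiven q ρ π z = ∑ ω : Fin d → Fin n → Bool × Bool,
      (∏ k, ∏ j, pairMass q ρ (ω k j)) * if observe π ω = z then 1 else 0 := by
  classical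
  -- For `j` outside the range of `π` the condition on `c.2` is vacuous, so summing over `c` leaves
  -- the marginal of `X`.
  let χ : Fin d → Fin n → Bool × Bool → ℝ := fun k j c =>
    if c.1 = z.1 j k ∧ ∀ i, π i = j → c.2 = z.2 i k then 1 else 0
  have h1 : ∀ ω : Fin d → Fin n → Bool × Bool,
      (if observe π ω = z then (1 : ℝ) else 0) = ∏ k, ∏ j, χ k j (ω k j) := fun ω => by
    simp only [χ, Finset.prod_boole, Finset.mem_univ, true_imp_iff]
    congr 1
    simp only [observe, Prod.ext_iff, funext_iff, eq_iff_iff]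
    constructor
    · rintro ⟨h, h'⟩ k j
      exact ⟨h j k, by rintro i rfl; exact h' i k⟩
    · intro h
      exact ⟨fun j k => (h k j).1, fun i k => (h k (π i)).2 i rfl⟩
  have h2 : ∀ ω : Fin d → Fin n → Bool × Bool, (∏ k, ∏ j, pairMass q ρ (ω k j)) *
      (if observe π ω = z then 1 else 0) =
      ∏ k, ∏ j, (pairMass q ρ (ω k j) * χ k j (ω k j)) := fun ω => by
    simp only [h1, Finset.prod_mul_distrib]
  let f : Fin n → ℝ := fun j => ∏ k, ∑ c, pairMass q ρ c * χ k j c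
  have h3 : ∑ ω : Fin d → Fin n → Bool × Bool,
      ∏ k, ∏ j, (pairMass q ρ (ω k j) * χ k j (ω k j)) = ∏ j, f j := by
    rw [Finset.prod_comm]
    simp only [Fintype.prod_sum]
  simp only [h2]
  rw [h3, ← prod_injection_mul_prod_compl π f, altMassGiven]
  congr 1
  · refine Finset.prod_congr rfl fun i _ => Finset.prod_congr rfl fun k _ => ?_
    have : ∀ c : Bool × Bool, χ k (π i) c = if c = (z.1 (π i) k, z.2 i k) then 1 else 0 :=
      fun c => by simp [χ, Prod.ext_iff]
    simp [this]
  · refine Finset.prod_congr rfl fun j _ => Finset.prod_congr rfl fun k _ => ?_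
    have : ∀ c : Bool × Bool, χ k j c = if c.1 = z.1 j k then 1 else 0 := fun c => by
      have : ∀ i, π i ≠ j := fun i hi => j.2 ⟨i, hi⟩
      simp [χ, this]
    rw [← sum_pairMass_right q ρ]
    cases h : z.1 j k <;> simp [this, h, Fintype.sum_prod_type]

theorem sum_altMassGiven_mul (q ρ : ℝ) (π : Fin m ↪ Fin n) (F : Data d n m → ℝ) :
    ∑ z, altMassGiven q ρ π z * F z = ∑ ω : Fin d → Fin n → Bool × Bool,
      (∏ k, ∏ j, pairMass q ρ (ω k j)) * F (observe π ω) := by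
  classical
  simp only [altMassGiven_eq_sum, Finset.sum_mul]
  rw [Finset.sum_comm]
  refine Finset.sum_congr rfl fun ω _ => ?_
  simp

theorem pairMass_zero (q : ℝ) (a b : Bool) : pairMass q 0 (a, b) = bernMass q a * bernMass q b := by
  cases a <;> cases b <;> simp [pairMass, bernMass]
  ring

/-- At `ρ = 0` the matching is invisible, so null computations are special cases of those under the
alternative, with any injection. -/
theorem nullMass_eq_altMassGiven (q : ℝ) (π : Fin m ↪ Fin n) (z : Data d n m) :
    nullMass q z = altMassGiven q 0 π z := by
  simp only [nullMass, altMassGiven, vecPairMass, pairMass_zero, Finset.prod_mul_distrib]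
  rw [← prod_injection_mul_prod_compl π]
  simp only [vecMass]
  ring

theorem sum_altMass_le {q ρ : ℝ} {T : Finset (Data d n m)} {b : ℝ} (hb : 0 ≤ b)
    (h : ∀ π : Fin m ↪ Fin n, ∑ z ∈ T, altMassGiven q ρ π z ≤ b) :
    ∑ z ∈ T, altMass q ρ z ≤ b := by
  simp only [altMass]
  rw [← Finset.mul_sum, Finset.sum_comm]
  calc _ ≤ (Fintype.card (Fin m ↪ Fin n) : ℝ)⁻¹ * ∑ _π : Fin m ↪ Fin n, b := by
        gcongr; exact h _
    _ = ((Fintype.card (Fin m ↪ Fin n) : ℝ)⁻¹ * Fintype.card (Fin m ↪ Fin n)) * b := by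
        rw [Finset.sum_const, nsmul_eq_mul, Finset.card_univ, mul_assoc]
    _ ≤ 1 * b := by gcongr; exact inv_mul_le_one
    _ = b := one_mul b

end Observe

/-! ### Moments of sums of independent centred variables. -/

section Independence

variable {Z : Type*} [Fintype Z] {n : ℕ} {w : Z → ℝ}

theorem sum_prod_mul_prod (w : Z → ℝ) (G : Fin n → Z → ℝ) :
    ∑ ω : Fin n → Z, (∏ j, w (ω j)) * ∏ j, G j (ω j) = ∏ j, ∑ c, w c * G j c := by
  simp only [← Finset.prod_mul_distrib, Fintype.prod_sum]

theorem sum_prod_eq_one (hw : ∑ c, w c = 1) : ∑ ω : Fin n → Z, ∏ j, w (ω j) = 1 := by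
  rw [← Fintype.prod_sum, hw, Finset.prod_const_one]

theorem sum_prod_mul_apply (hw : ∑ c, w c = 1) (i : Fin n) (f : Z → ℝ) :
    ∑ ω : Fin n → Z, (∏ j, w (ω j)) * f (ω i) = ∑ c, w c * f c := by
  have h := sum_prod_mul_prod w fun j c => if j = i then f c else 1
  have h1 : ∀ ω : Fin n → Z, ∏ j, (if j = i then f (ω j) else 1) = f (ω i) := fun ω => by simp
  simp only [h1] at h
  rw [h, Finset.prod_eq_single i (fun j _ hj => by simp [hj, hw]) (by simp)]
  simp

theorem sum_prod_mul_apply_apply (hw : ∑ c, w c = 1) {i i' : Fin n} (hi : i ≠ i') (f g : Z → ℝ) :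
    ∑ ω : Fin n → Z, (∏ j, w (ω j)) * (f (ω i) * g (ω i')) =
      (∑ c, w c * f c) * ∑ c, w c * g c := by
  have h := sum_prod_mul_prod w fun j c => (if j = i then f c else 1) * if j = i' then g c else 1
  have h1 : ∀ ω : Fin n → Z, ∏ j, ((if j = i then f (ω j) else 1) *
      if j = i' then g (ω j) else 1) = f (ω i) * g (ω i') := fun ω => by
    rw [Finset.prod_mul_distrib]; simp
  simp only [h1] at h
  rw [h, ← Finset.mul_prod_erase _ _ (Finset.mem_univ i),
    ← Finset.mul_prod_erase _ _ (Finset.mem_erase.2 ⟨hi.symm, Finset.mem_univ i'⟩),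
    Finset.prod_eq_one]
  · simp [hi, hi.symm]
  · intro j hj
    simp only [Finset.mem_erase] at hj
    simp [hj.1, hj.2.1, hw]

theorem sum_prod_mul_sum (hw : ∑ c, w c = 1) (u : Fin n → Z → ℝ) :
    ∑ ω : Fin n → Z, (∏ j, w (ω j)) * ∑ j, u j (ω j) = ∑ j, ∑ c, w c * u j c := by
  simp only [Finset.mul_sum]
  rw [Finset.sum_comm]
  refine Finset.sum_congr rfl fun j _ => sum_prod_mul_apply hw j (u j)

theorem sum_prod_mul_sum_mul_sum (hw : ∑ c, w c = 1) (u v : Fin n → Z → ℝ)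
    (hu : ∀ j, ∑ c, w c * u j c = 0) :
    ∑ ω : Fin n → Z, (∏ j, w (ω j)) * ((∑ j, u j (ω j)) * ∑ j, v j (ω j)) =
      ∑ j, ∑ c, w c * (u j c * v j c) := by
  simp only [Finset.sum_mul_sum]
  simp only [Finset.mul_sum]
  rw [Finset.sum_comm]
  refine Finset.sum_congr rfl fun i _ => ?_
  rw [Finset.sum_comm, Finset.sum_eq_single i (fun i' _ hi' => ?_) (by simp)]
  · exact sum_prod_mul_apply hw i fun c => u i c * v i c
  · rw [sum_prod_mul_apply_apply hw hi'.symm, hu, zero_mul]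

theorem sum_prod_fin_succ (w : Z → ℝ) (f : (Fin (n + 1) → Z) → ℝ) :
    ∑ ω : Fin (n + 1) → Z, (∏ j, w (ω j)) * f ω =
      ∑ c, w c * ∑ ω : Fin n → Z, (∏ j, w (ω j)) * f (Fin.cons c ω) := by
  rw [← (Fin.consEquiv fun _ : Fin (n + 1) => Z).sum_comp, Fintype.sum_prod_type]
  refine Finset.sum_congr rfl fun c _ => ?_
  rw [Finset.mul_sum]
  refine Finset.sum_congr rfl fun ω _ => ?_
  simp [Fin.consEquiv, Fin.prod_univ_succ, mul_assoc]

/-- Wick-type formula: the pairings give `AB + 2C²`, and the last sum collects the joint fourth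
cumulants, which are additive under independence. -/
theorem sum_prod_mul_sum_sq_mul_sum_sq (hw : ∑ c, w c = 1) (u v : Fin n → Z → ℝ)
    (hu : ∀ j, ∑ c, w c * u j c = 0) (hv : ∀ j, ∑ c, w c * v j c = 0) :
    ∑ ω : Fin n → Z, (∏ j, w (ω j)) * ((∑ j, u j (ω j)) ^ 2 * (∑ j, v j (ω j)) ^ 2) =
      (∑ j, ∑ c, w c * (u j c * u j c)) * (∑ j, ∑ c, w c * (v j c * v j c)) +
      2 * (∑ j, ∑ c, w c * (u j c * v j c)) ^ 2 +
      ∑ j, (∑ c, w c * (u j c ^ 2 * v j c ^ 2) -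
        (∑ c, w c * (u j c * u j c)) * (∑ c, w c * (v j c * v j c)) -
        2 * (∑ c, w c * (u j c * v j c)) ^ 2) := by
  induction n with
  | zero => simp
  | succ n ih =>
    have ih := ih (fun j => u j.succ) (fun j => v j.succ) (fun j => hu _) (fun j => hv _)
    have e1 := sum_prod_mul_sum hw fun j : Fin n => u j.succ
    have e2 := sum_prod_mul_sum hw fun j : Fin n => v j.succ
    have e11 := sum_prod_mul_sum_mul_sum hw (fun j : Fin n => u j.succ)
      (fun j : Fin n => u j.succ) (fun j => hu _)
    have e12 := sum_prod_mul_sum_mul_sum hw (fun j : Fin n => u j.succ)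
      (fun j : Fin n => v j.succ) (fun j => hu _)
    have e22 := sum_prod_mul_sum_mul_sum hw (fun j : Fin n => v j.succ)
      (fun j : Fin n => v j.succ) (fun j => hv _)
    have e0 := sum_prod_eq_one (n := n) hw
    simp only [hu, hv, Finset.sum_const_zero] at e1 e2
    rw [sum_prod_fin_succ]
    simp only [Fin.sum_univ_succ, Fin.cons_zero, Fin.cons_succ]
    generalize hA : ∑ j : Fin n, ∑ c, w c * (u j.succ c * u j.succ c) = A at *
    generalize hB : ∑ j : Fin n, ∑ c, w c * (v j.succ c * v j.succ c) = B at *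
    generalize hC : ∑ j : Fin n, ∑ c, w c * (u j.succ c * v j.succ c) = C at *
    generalize hK : ∑ j : Fin n, (∑ c, w c * (u j.succ c ^ 2 * v j.succ c ^ 2) -
        (∑ c, w c * (u j.succ c * u j.succ c)) * (∑ c, w c * (v j.succ c * v j.succ c)) -
        2 * (∑ c, w c * (u j.succ c * v j.succ c)) ^ 2) = K at *
    let S : (Fin n → Z) → ℝ := fun ω => ∑ j, u j.succ (ω j)
    let S' : (Fin n → Z) → ℝ := fun ω => ∑ j, v j.succ (ω j)
    let W : (Fin n → Z) → ℝ := fun ω => ∏ j, w (ω j)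
    change ∑ ω, W ω * (S ω ^ 2 * S' ω ^ 2) = _ at ih
    change ∑ ω, W ω * S ω = 0 at e1
    change ∑ ω, W ω * S' ω = 0 at e2
    change ∑ ω, W ω * (S ω * S ω) = A at e11
    change ∑ ω, W ω * (S ω * S' ω) = C at e12
    change ∑ ω, W ω * (S' ω * S' ω) = B at e22
    change ∑ ω, W ω = 1 at e0
    -- The mixed third moments need not be evaluated: they multiply `x` or `y` alone, and these
    -- average to zero over the variable being added.
    have hin : ∀ x y : ℝ, ∑ ω, W ω * ((x + S ω) ^ 2 * (y + S' ω) ^ 2) =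
        (A * B + 2 * C ^ 2 + K) + 2 * (∑ ω, W ω * (S ω ^ 2 * S' ω)) * y + A * y ^ 2 +
        2 * (∑ ω, W ω * (S ω * S' ω ^ 2)) * x + 4 * C * (x * y) + B * x ^ 2 + x ^ 2 * y ^ 2 := by
      intro x y
      have : ∀ ω, W ω * ((x + S ω) ^ 2 * (y + S' ω) ^ 2) =
          W ω * (S ω ^ 2 * S' ω ^ 2) + 2 * y * (W ω * (S ω ^ 2 * S' ω)) +
          y ^ 2 * (W ω * (S ω * S ω)) + 2 * x * (W ω * (S ω * S' ω ^ 2)) +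
          4 * (x * y) * (W ω * (S ω * S' ω)) + 2 * x * y ^ 2 * (W ω * S ω) +
          x ^ 2 * (W ω * (S' ω * S' ω)) + 2 * x ^ 2 * y * (W ω * S' ω) +
          x ^ 2 * y ^ 2 * W ω := fun ω => by ring
      simp only [this, Finset.sum_add_distrib, ← Finset.mul_sum, ih, e1, e2, e11, e12, e22, e0]
      ring
    change ∑ c, w c * ∑ ω, W ω * ((u 0 c + S ω) ^ 2 * (v 0 c + S' ω) ^ 2) = _
    simp only [hin]
    generalize ∑ ω, W ω * (S ω ^ 2 * S' ω) = M
    generalize ∑ ω, W ω * (S ω * S' ω ^ 2) = M'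
    have : ∀ c, w c * ((A * B + 2 * C ^ 2 + K) + 2 * M * v 0 c + A * v 0 c ^ 2 +
        2 * M' * u 0 c + 4 * C * (u 0 c * v 0 c) + B * u 0 c ^ 2 + u 0 c ^ 2 * v 0 c ^ 2) =
        (A * B + 2 * C ^ 2 + K) * w c + 2 * M * (w c * v 0 c) + A * (w c * (v 0 c * v 0 c)) +
        2 * M' * (w c * u 0 c) + 4 * C * (w c * (u 0 c * v 0 c)) +
        B * (w c * (u 0 c * u 0 c)) + w c * (u 0 c ^ 2 * v 0 c ^ 2) := fun c => by ring
    simp only [this, Finset.sum_add_distrib, ← Finset.mul_sum, hw, hu, hv]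
    ring

/-- Chebyshev's inequality for finite sums. -/
theorem sum_le_of_sq_le {Ω : Type*} [Fintype Ω] {W G : Ω → ℝ} (hW : ∀ ω, 0 ≤ W ω)
    {T : Finset Ω} {t v : ℝ} (ht : 0 < t) (hT : ∀ ω ∈ T, t ≤ |G ω|)
    (hv : ∑ ω, W ω * G ω ^ 2 ≤ v) : ∑ ω ∈ T, W ω ≤ v / t ^ 2 := by
  rw [le_div_iff₀ (by positivity), Finset.sum_mul]
  refine le_trans ?_ hv
  refine le_trans (Finset.sum_le_sum fun ω hω => ?_)
    (Finset.sum_le_univ_sum_of_nonneg (s := T) fun ω => mul_nonneg (hW ω) (sq_nonneg (G ω)))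
  have := hT ω hω
  rw [← sq_abs (G ω)]
  have := hW ω
  gcongr

end Independence

/-! ### The inner product test for growing dimension. -/

/-- The deviation of a Bernoulli variable from its mean. -/
def dev (q : ℝ) (b : Bool) : ℝ := (if b then 1 else 0) - q

theorem sum_pairMass_mul_dev_fst (q ρ : ℝ) : ∑ c, pairMass q ρ c * dev q c.1 = 0 := by
  simp [Fintype.sum_prod_type, pairMass, dev]; ring

theorem sum_pairMass_mul_dev_snd (q ρ : ℝ) : ∑ c, pairMass q ρ c * dev q c.2 = 0 := by
  simp [Fintype.sum_prod_type, pairMass, dev]; ring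

theorem sum_pairMass_mul_dev_fst_fst (q ρ : ℝ) :
    ∑ c, pairMass q ρ c * (dev q c.1 * dev q c.1) = q * (1 - q) := by
  simp [Fintype.sum_prod_type, pairMass, dev]; ring

theorem sum_pairMass_mul_dev_snd_snd (q ρ : ℝ) :
    ∑ c, pairMass q ρ c * (dev q c.2 * dev q c.2) = q * (1 - q) := by
  simp [Fintype.sum_prod_type, pairMass, dev]; ring

theorem sum_pairMass_mul_dev_fst_snd (q ρ : ℝ) :
    ∑ c, pairMass q ρ c * (dev q c.1 * dev q c.2) = ρ * (q * (1 - q)) := by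
  simp [Fintype.sum_prod_type, pairMass, dev]; ring

theorem sum_pairMass_mul_dev_sq_mul_dev_sq (q ρ : ℝ) :
    ∑ c, pairMass q ρ c * (dev q c.1 ^ 2 * dev q c.2 ^ 2) =
      (q * (1 - q)) ^ 2 + (1 - 2 * q) ^ 2 * (ρ * (q * (1 - q))) := by
  simp [Fintype.sum_prod_type, pairMass, dev]; ring

section Column

variable {n m : ℕ}

/-- The product of the centred sums of the `X`s and of the `Y`s in one coordinate. -/
noncomputable def columnStat (q : ℝ) (π : Fin m ↪ Fin n) (ω : Fin n → Bool × Bool) : ℝ :=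
  (∑ j, dev q (ω j).1) * ∑ i, dev q (ω (π i)).2

theorem sum_injection (π : Fin m ↪ Fin n) (f : Fin n → ℝ) :
    ∑ i, f (π i) = ∑ j, (if j ∈ Finset.univ.map π then 1 else 0) * f j := by
  simp only [ite_mul, one_mul, zero_mul]
  rw [← Finset.sum_filter, Finset.filter_mem_eq_inter, Finset.univ_inter, Finset.sum_map]

/-- The sum of the matched `Y`s is a sum over all of `[n]` weighted by the indicator of the range of
`π`; the general moment formulas then apply. -/
theorem columnStat_moments (q ρ : ℝ) (π : Fin m ↪ Fin n) :
    (∑ ω, (∏ j, pairMass q ρ (ω j)) * columnStat q π ω = m * (ρ * (q * (1 - q)))) ∧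
    ∑ ω, (∏ j, pairMass q ρ (ω j)) * columnStat q π ω ^ 2 =
      n * m * (q * (1 - q)) ^ 2 + m ^ 2 * ρ ^ 2 * (q * (1 - q)) ^ 2 +
        (m * (ρ * (q * (1 - q)))) ^ 2 +
        m * ((1 - 2 * q) ^ 2 * (ρ * (q * (1 - q))) - 2 * ρ ^ 2 * (q * (1 - q)) ^ 2) := by
  let e : Fin n → ℝ := fun j => if j ∈ Finset.univ.map π then 1 else 0
  have he : ∑ j, e j = m := by
    have := sum_injection π fun _ => 1
    simp only [mul_one, Finset.sum_const, nsmul_eq_mul, Finset.card_univ, Fintype.card_fin] at this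
    exact this.symm
  have he2 : ∀ j, e j ^ 2 = e j := fun j => by simp only [e]; split_ifs <;> simp
  have hY : ∀ ω : Fin n → Bool × Bool, ∑ i, dev q (ω (π i)).2 = ∑ j, e j * dev q (ω j).2 :=
    fun ω => sum_injection π fun j => dev q (ω j).2
  let u : Fin n → Bool × Bool → ℝ := fun _ c => dev q c.1
  let v : Fin n → Bool × Bool → ℝ := fun j c => e j * dev q c.2
  have hw := sum_pairMass q ρ
  have hu : ∀ j, ∑ c, pairMass q ρ c * u j c = 0 := fun _ => sum_pairMass_mul_dev_fst q ρ
  have hv : ∀ j, ∑ c, pairMass q ρ c * v j c = 0 := fun j => by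
    simp only [v, mul_left_comm _ (e j), ← Finset.mul_sum, sum_pairMass_mul_dev_snd, mul_zero]
  have huu : ∀ j, ∑ c, pairMass q ρ c * (u j c * u j c) = q * (1 - q) :=
    fun _ => sum_pairMass_mul_dev_fst_fst q ρ
  have huv : ∀ j, ∑ c, pairMass q ρ c * (u j c * v j c) = e j * (ρ * (q * (1 - q))) := fun j => by
    simp only [u, v, mul_left_comm _ (e j), ← Finset.mul_sum, sum_pairMass_mul_dev_fst_snd]
  have hvv : ∀ j, ∑ c, pairMass q ρ c * (v j c * v j c) = e j * (q * (1 - q)) := fun j => by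
    rw [← he2 j, ← sum_pairMass_mul_dev_snd_snd q ρ, Finset.mul_sum]
    exact Finset.sum_congr rfl fun c _ => by simp only [v]; ring
  have h4 : ∀ j, ∑ c, pairMass q ρ c * (u j c ^ 2 * v j c ^ 2) =
      e j * ((q * (1 - q)) ^ 2 + (1 - 2 * q) ^ 2 * (ρ * (q * (1 - q)))) := fun j => by
    rw [← he2 j, ← sum_pairMass_mul_dev_sq_mul_dev_sq q ρ, Finset.mul_sum]
    exact Finset.sum_congr rfl fun c _ => by simp only [u, v]; ring
  simp only [columnStat, hY]
  constructor
  · refine (sum_prod_mul_sum_mul_sum hw u v hu).trans ?_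
    simp only [huv, ← Finset.sum_mul, he]
  · have h := sum_prod_mul_sum_sq_mul_sum_sq hw u v hu hv
    simp only [huu, huv, hvv, h4, mul_pow, he2] at h
    simp only [mul_pow]
    refine h.trans ?_
    have : ∀ j, e j * ((q ^ 2 * (1 - q) ^ 2) + (1 - 2 * q) ^ 2 * (ρ * (q * (1 - q)))) -
        q * (1 - q) * (e j * (q * (1 - q))) - 2 * (e j * (ρ ^ 2 * (q ^ 2 * (1 - q) ^ 2))) =
        e j * ((1 - 2 * q) ^ 2 * (ρ * (q * (1 - q))) - 2 * ρ ^ 2 * (q ^ 2 * (1 - q) ^ 2)) :=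
      fun j => by ring
    simp only [this, ← Finset.sum_mul, he, Finset.sum_const, Finset.card_univ, Fintype.card_fin,
      nsmul_eq_mul]
    ring

end Column

section Statistic

variable {d n m : ℕ}

/-- The inner product of the centred sums of the `X`s and of the `Y`s. -/
noncomputable def statistic (q : ℝ) (z : Data d n m) : ℝ :=
  ∑ k, (∑ j, dev q (z.1 j k)) * ∑ i, dev q (z.2 i k)

/-- The statistic is a sum over coordinates of independent copies of `columnStat`, so variances add.
-/
theorem sum_altMassGiven_mul_statistic_sq (q ρ : ℝ) (π : Fin m ↪ Fin n) :
    ∑ z : Data d n m, altMassGiven q ρ π z * (statistic q z - d * (m * (ρ * (q * (1 - q))))) ^ 2 =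
      d * (n * m * (q * (1 - q)) ^ 2 + m ^ 2 * ρ ^ 2 * (q * (1 - q)) ^ 2 +
        m * ((1 - 2 * q) ^ 2 * (ρ * (q * (1 - q))) - 2 * ρ ^ 2 * (q * (1 - q)) ^ 2)) := by
  obtain ⟨h1, h2⟩ := columnStat_moments q ρ π
  set μ : ℝ := m * (ρ * (q * (1 - q))) with hμ
  have hw : ∑ ω : Fin n → Bool × Bool, ∏ j, pairMass q ρ (ω j) = 1 :=
    sum_prod_eq_one (sum_pairMass q ρ)
  have h0 : ∑ ω, (∏ j, pairMass q ρ (ω j)) * (columnStat q π ω - μ) = 0 := by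
    simp only [mul_sub, Finset.sum_sub_distrib, h1, ← Finset.sum_mul, hw, one_mul, sub_self]
  have h3 : ∑ ω, (∏ j, pairMass q ρ (ω j)) * ((columnStat q π ω - μ) * (columnStat q π ω - μ)) =
      n * m * (q * (1 - q)) ^ 2 + m ^ 2 * ρ ^ 2 * (q * (1 - q)) ^ 2 +
        m * ((1 - 2 * q) ^ 2 * (ρ * (q * (1 - q))) - 2 * ρ ^ 2 * (q * (1 - q)) ^ 2) := by
    have : ∀ ω, (∏ j, pairMass q ρ (ω j)) * ((columnStat q π ω - μ) * (columnStat q π ω - μ)) =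
        (∏ j, pairMass q ρ (ω j)) * columnStat q π ω ^ 2 -
        2 * μ * ((∏ j, pairMass q ρ (ω j)) * columnStat q π ω) +
        μ ^ 2 * ∏ j, pairMass q ρ (ω j) := fun ω => by ring
    simp only [this, Finset.sum_add_distrib, Finset.sum_sub_distrib, ← Finset.mul_sum, h1, h2, hw]
    ring
  have key := sum_prod_mul_sum_mul_sum (n := d) hw (fun _ ω => columnStat q π ω - μ)
    (fun _ ω => columnStat q π ω - μ) fun _ => h0
  rw [sum_altMassGiven_mul]
  have hs : ∀ ω : Fin d → Fin n → Bool × Bool, statistic q (observe π ω) - d * μ =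
      ∑ k, (columnStat q π (ω k) - μ) := fun ω => by
    rw [Finset.sum_sub_distrib, Finset.sum_const, Finset.card_univ, Fintype.card_fin,
      nsmul_eq_mul]
    rfl
  simp only [hs, sq (∑ k, _)]
  refine key.trans ?_
  rw [h3, Finset.sum_const, Finset.card_univ, Fintype.card_fin, nsmul_eq_mul]

theorem sum_nullMass_mul_statistic_sq (q : ℝ) (hmn : m ≤ n) :
    ∑ z : Data d n m, nullMass q z * statistic q z ^ 2 = d * (n * m * (q * (1 - q)) ^ 2) := by
  have := sum_altMassGiven_mul_statistic_sq (d := d) q 0 (Fin.castLEEmb hmn)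
  simp only [nullMass_eq_altMassGiven q (Fin.castLEEmb hmn)]
  simpa using this

theorem exists_statistic_test {q ρ : ℝ} (h : Admissible q ρ) (hmn : m ≤ n)
    (hpos : 0 < d * (m * (|ρ| * (q * (1 - q))))) :
    ∃ T : Finset (Data d n m),
      ∑ z ∈ T, nullMass q z ≤ 4 * (n / (d * m * ρ ^ 2)) ∧
      ∑ z ∈ Tᶜ, altMass q ρ z ≤
        4 * (n / (d * m * ρ ^ 2) + 1 / d + 1 / (d * m * (|ρ| * (q * (1 - q))))) := by
  classical
  set v : ℝ := q * (1 - q) with hv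
  set θ : ℝ := d * (m * (|ρ| * v)) with hθ
  have hv0 : 0 ≤ v := mul_nonneg h.1 (by linarith [h.2.1])
  have hd0 : (0 : ℝ) < d := by
    refine lt_of_le_of_ne (Nat.cast_nonneg _) fun h0 => ?_
    rw [hθ, ← h0] at hpos; simp at hpos
  have hm0 : (0 : ℝ) < m := by
    refine lt_of_le_of_ne (Nat.cast_nonneg _) fun h0 => ?_
    rw [hθ, ← h0] at hpos; simp at hpos
  have hρ0 : 0 < |ρ| := by
    refine lt_of_le_of_ne (abs_nonneg _) fun h0 => ?_
    rw [hθ, ← h0] at hpos; simp at hpos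
  have hv1 : 0 < v := by
    refine lt_of_le_of_ne hv0 fun h0 => ?_
    rw [hθ, ← h0] at hpos; simp at hpos
  have hρ2 : ρ ^ 2 = |ρ| ^ 2 := (sq_abs ρ).symm
  -- The threshold is half the absolute mean under the alternative; either error is then a deviation
  -- by at least `θ / 2`.
  refine ⟨Finset.univ.filter fun z => θ / 2 ≤ |statistic q z|, ?_, ?_⟩
  · refine (sum_le_of_sq_le (nullMass_nonneg h.1 h.2.1) (half_pos hpos)
      (fun z hz => (Finset.mem_filter.1 hz).2)
      (sum_nullMass_mul_statistic_sq q hmn).le).trans_eq ?_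
    rw [hρ2, ← hv, hθ]
    field_simp
    norm_num
  · refine sum_altMass_le (by positivity) fun π => ?_
    have hvar := (sum_altMassGiven_mul_statistic_sq (d := d) q ρ π).le
    rw [← hv] at hvar
    have hθ' : |d * (m * (ρ * v))| = θ := by
      rw [abs_mul, abs_mul, abs_mul, abs_of_pos hv1, abs_of_pos hd0, abs_of_pos hm0]
    refine (sum_le_of_sq_le (altMassGiven_nonneg h π) (half_pos hpos)
      (fun z hz => ?_) hvar).trans ?_
    · simp only [Finset.mem_compl, Finset.mem_filter, Finset.mem_univ, true_and, not_le] at hz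
      have := abs_sub_abs_le_abs_sub (d * (m * (ρ * v))) (statistic q z)
      rw [abs_sub_comm] at this
      linarith
    · have h1 : (1 - 2 * q) ^ 2 * (ρ * v) - 2 * ρ ^ 2 * v ^ 2 ≤ |ρ| * v := by
        have h2 : (1 - 2 * q) ^ 2 ≤ 1 := by nlinarith [h.1, h.2.1]
        have h3 : (1 - 2 * q) ^ 2 * (ρ * v) ≤ 1 * (|ρ| * v) := by
          have := le_abs_self ρ
          calc (1 - 2 * q) ^ 2 * (ρ * v) ≤ (1 - 2 * q) ^ 2 * (|ρ| * v) := by gcongr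
            _ ≤ 1 * (|ρ| * v) := by gcongr
        nlinarith [sq_nonneg (ρ * v)]
      calc _ ≤ d * (n * m * v ^ 2 + m ^ 2 * ρ ^ 2 * v ^ 2 + m * (|ρ| * v)) / (θ / 2) ^ 2 := by
            gcongr
        _ = _ := by
            rw [hρ2, hθ]
            field_simp
            norm_num

end Statistic

theorem floor_mul_le {α : ℝ} (hα1 : α ≤ 1) (n : ℕ) : ⌊α * (n : ℝ)⌋₊ ≤ n :=
  Nat.floor_le_of_le (mul_le_of_le_one_left (Nat.cast_nonneg _) hα1)

theorem eventually_le_floor_mul {α : ℝ} (hα0 : 0 < α) {n : ℕ → ℕ} (hn : Tendsto n atTop atTop) :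
    ∀ᶠ k in atTop, α * n k / 2 ≤ (⌊α * (n k : ℝ)⌋₊ : ℝ) := by
  have h1 : Tendsto (fun k => α * (n k : ℝ)) atTop atTop :=
    (tendsto_natCast_atTop_atTop.comp hn).const_mul_atTop hα0
  filter_upwards [h1.eventually_ge_atTop 2] with k hk
  linarith [Nat.lt_floor_add_one (α * (n k : ℝ))]

theorem strongDetection_of_tendsto {α : ℝ} (hα0 : 0 < α) (hα1 : α ≤ 1) {n d : ℕ → ℕ}
    (hn : Tendsto n atTop atTop) {q ρ : ℕ → ℝ} (h : ∀ k, Admissible (q k) (ρ k))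
    (hq : ∀ k, q k ≤ 1 / 2) (hd : Tendsto d atTop atTop)
    (h1 : Tendsto (fun k => ρ k ^ 2 * (d k : ℝ)) atTop atTop)
    (h2 : Tendsto (fun k => (n k : ℝ) * (d k : ℝ) * q k * |ρ k|) atTop atTop) :
    StrongDetection (fun k => bernoulliModel (d k) (q k) (ρ k)) n
      (fun k => ⌊α * (n k : ℝ)⌋₊) := by
  rw [strongDetection_iff h fun k => floor_mul_le hα1 _]
  intro δ hδ
  -- The constants come from `m ≥ α n / 2`, valid for large `n`, and `q (1 - q) ≥ q / 2`, valid for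
  -- `q ≤ 1/2`.
  have hlim : Tendsto (fun k => 4 * (2 / α * (ρ k ^ 2 * (d k : ℝ))⁻¹ + ((d k : ℝ))⁻¹ +
      4 / α * ((n k : ℝ) * (d k : ℝ) * q k * |ρ k|)⁻¹)) atTop
      (𝓝 (4 * (2 / α * 0 + 0 + 4 / α * 0))) :=
    ((((tendsto_inv_atTop_zero.comp h1).const_mul _).add
      (tendsto_inv_atTop_zero.comp (tendsto_natCast_atTop_atTop.comp hd))).add
      ((tendsto_inv_atTop_zero.comp h2).const_mul _)).const_mul _
  filter_upwards [hlim.eventually_lt_const (u := δ) (by simpa using hδ),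
    eventually_le_floor_mul hα0 hn, hn.eventually_gt_atTop 0, hd.eventually_gt_atTop 0,
    h1.eventually_gt_atTop 0, h2.eventually_gt_atTop 0] with k hk hm hn0 hd0 h10 h20
  have hn0' : (0 : ℝ) < n k := by exact_mod_cast hn0
  have hd0' : (0 : ℝ) < d k := by exact_mod_cast hd0
  have hρ0 : 0 < |ρ k| := by
    refine lt_of_le_of_ne (abs_nonneg _) fun h0 => ?_
    rw [← h0] at h20; simp at h20
  have hρ2 : 0 < ρ k ^ 2 := by rw [← sq_abs]; positivity
  have hq0 : 0 < q k := by
    refine lt_of_le_of_ne (h k).1 fun h0 => ?_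
    rw [← h0] at h20; simp at h20
  have hv : q k / 2 ≤ q k * (1 - q k) := by nlinarith [hq k]
  have hm0 : 0 < α * n k / 2 := by positivity
  obtain ⟨T, hT1, hT2⟩ := exists_statistic_test (d := d k) (h k) (floor_mul_le hα1 (n k))
    (mul_pos hd0' (mul_pos (hm0.trans_le hm) (mul_pos hρ0 (by linarith))))
  have e1 : (n k : ℝ) / (d k * (⌊α * (n k : ℝ)⌋₊ : ℝ) * ρ k ^ 2) ≤
      2 / α * (ρ k ^ 2 * (d k : ℝ))⁻¹ := by
    calc _ ≤ (n k : ℝ) / (d k * (α * n k / 2) * ρ k ^ 2) := by gcongr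
      _ = _ := by field_simp
  have e2 : 1 / (d k * (⌊α * (n k : ℝ)⌋₊ : ℝ) * (|ρ k| * (q k * (1 - q k)))) ≤
      4 / α * ((n k : ℝ) * (d k : ℝ) * q k * |ρ k|)⁻¹ := by
    calc _ ≤ 1 / (d k * (α * n k / 2) * (|ρ k| * (q k / 2))) := by gcongr
      _ = _ := by field_simp; norm_num
  have e3 : 0 ≤ ((d k : ℝ))⁻¹ := by positivity
  have e4 : 0 ≤ 4 / α * ((n k : ℝ) * (d k : ℝ) * q k * |ρ k|)⁻¹ := by positivity
  refine ⟨T, by linarith, ?_⟩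
  rw [one_div (d k : ℝ)] at hT2
  linarith

/-! ### Anticoncentration of the binomial distribution. -/

section SmallBall

variable {n : ℕ}

/-- The number of successes. -/
def successes (x : Fin n → Bool) : ℤ := ∑ j, if x j then 1 else 0

theorem sum_bernMass_mul_dev (q : ℝ) : ∑ b, bernMass q b * dev q b = 0 := by
  simp [bernMass, dev]; ring

theorem sum_bernMass_mul_dev_dev (q : ℝ) :
    ∑ b, bernMass q b * (dev q b * dev q b) = q * (1 - q) := by
  simp [bernMass, dev]; ring

theorem sum_dev (q : ℝ) (x : Fin n → Bool) : ∑ j, dev q (x j) = successes x - n * q := by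
  simp [dev, successes, Finset.sum_sub_distrib]

/-- Averaging over coordinate `j` alone gives zero unless that coordinate decides the indicator,
that is, unless the other `n` coordinates have exactly `i` successes. -/
theorem sum_bernMass_mul_dev_mul (q : ℝ) (i : ℤ) (j : Fin (n + 1)) :
    ∑ x : Fin (n + 1) → Bool, (∏ j, bernMass q (x j)) *
      (dev q (x j) * if i + 1 ≤ successes x then 1 else 0) =
    q * (1 - q) * ∑ x : Fin n → Bool, (∏ j, bernMass q (x j)) *
      if successes x = i then 1 else 0 := by
  rw [← (Fin.insertNthEquiv (fun _ => Bool) j).sum_comp, Fintype.sum_prod_type, Fintype.sum_bool,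
    ← Finset.sum_add_distrib, Finset.mul_sum]
  refine Finset.sum_congr rfl fun x _ => ?_
  have hs : ∀ b, successes (Fin.insertNthEquiv (fun _ => Bool) j (b, x)) =
      (if b then 1 else 0) + successes x := fun b => by
    change successes (j.insertNth b x : Fin (n + 1) → Bool) = _
    simp [successes, Fin.sum_univ_succAbove _ j]
  simp only [hs, Fin.insertNthEquiv_apply, Fin.prod_univ_succAbove _ j, Fin.insertNth_apply_same,
    Fin.insertNth_apply_succAbove]
  rcases lt_trichotomy (successes x) i with h | h | h
  · have h1 : ¬ i + 1 ≤ 1 + successes x := by omega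
    have h2 : ¬ i + 1 ≤ 0 + successes x := by omega
    simp only [if_true, Bool.false_eq_true, if_false, h1, h2, h.ne, mul_zero, add_zero]
  · simp only [if_true, Bool.false_eq_true, if_false, h]
    simp [bernMass, dev]
    ring
  · have h1 : i + 1 ≤ 1 + successes x := by omega
    have h2 : i + 1 ≤ 0 + successes x := by omega
    simp only [if_true, Bool.false_eq_true, if_false, h1, h2, h.ne']
    simp [bernMass, dev]
    ring

/-- Every atom of a binomial distribution has mass at most the inverse of its standard
deviation. -/
theorem mul_sq_binomial_atom_le {q : ℝ} (h0 : 0 ≤ q) (h1 : q ≤ 1) (i : ℤ) :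
    n * (q * (1 - q)) * (∑ x : Fin n → Bool, (∏ j, bernMass q (x j)) *
      if successes x = i then 1 else 0) ^ 2 ≤ 1 := by
  set p : ℝ := ∑ x : Fin n → Bool, (∏ j, bernMass q (x j)) * if successes x = i then 1 else 0
  let W : (Fin (n + 1) → Bool) → ℝ := fun x => ∏ j, bernMass q (x j)
  let S : (Fin (n + 1) → Bool) → ℝ := fun x => ∑ j, dev q (x j)
  let f : (Fin (n + 1) → Bool) → ℝ := fun x => if i + 1 ≤ successes x then 1 else 0
  have hW : ∀ x, 0 ≤ W x := fun x => Finset.prod_nonneg fun j _ => bernMass_nonneg h0 h1 _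
  have hw := sum_bernMass q
  have e1 : ∑ x, W x * (S x * f x) = (n + 1) * (q * (1 - q)) * p := by
    simp only [S, Finset.sum_mul]
    simp only [Finset.mul_sum]
    rw [Finset.sum_comm]
    simp only [W, f, sum_bernMass_mul_dev_mul]
    rw [Finset.sum_const, Finset.card_univ, Fintype.card_fin, nsmul_eq_mul]
    push_cast
    ring
  have e2 : ∑ x, W x * (S x * S x) = (n + 1) * (q * (1 - q)) := by
    refine (sum_prod_mul_sum_mul_sum hw (fun _ => dev q) (fun _ => dev q)
      fun _ => sum_bernMass_mul_dev q).trans ?_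
    simp only [sum_bernMass_mul_dev_dev, Finset.sum_const, Finset.card_univ, Fintype.card_fin,
      nsmul_eq_mul]
    push_cast
    ring
  have e3 : ∑ x, W x * (f x * f x) ≤ 1 := by
    rw [← sum_prod_eq_one (n := n + 1) hw]
    refine Finset.sum_le_sum fun x _ => mul_le_of_le_one_right (hW x) ?_
    simp only [f]; split_ifs <;> norm_num
  -- This is Cauchy–Schwarz for `S` and the threshold indicator `f` on `n + 1` trials: their
  -- covariance is `(n + 1) v p` and the variance of `S` is `(n + 1) v`, so `(n + 1) v p² ≤ 1`.
  have e4 : 0 ≤ ∑ x, W x * (p * S x - f x) ^ 2 :=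
    Finset.sum_nonneg fun x _ => mul_nonneg (hW x) (sq_nonneg _)
  have e5 : ∀ x, W x * (p * S x - f x) ^ 2 =
      p ^ 2 * (W x * (S x * S x)) - 2 * p * (W x * (S x * f x)) + W x * (f x * f x) :=
    fun x => by ring
  simp only [e5, Finset.sum_add_distrib, Finset.sum_sub_distrib, ← Finset.mul_sum, e1, e2] at e4
  have hv : 0 ≤ q * (1 - q) := mul_nonneg h0 (by linarith)
  nlinarith [mul_nonneg hv (sq_nonneg p)]

theorem sum_bernMass_ball_le {q t : ℝ} (h0 : 0 ≤ q) (h1 : q ≤ 1) (ht : 0 ≤ t) (c : ℝ)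
    (hv : 0 < n * (q * (1 - q))) :
    ∑ x : Fin n → Bool, (∏ j, bernMass q (x j)) *
      (if |(successes x : ℝ) - c| ≤ t then 1 else 0) ≤
      (2 * t + 1) / √(n * (q * (1 - q))) := by
  have hsq := Real.sqrt_pos.2 hv
  have hW : ∀ x : Fin n → Bool, 0 ≤ ∏ j, bernMass q (x j) :=
    fun x => Finset.prod_nonneg fun j _ => bernMass_nonneg h0 h1 _
  have hatom : ∀ i : ℤ, ∑ x : Fin n → Bool, (∏ j, bernMass q (x j)) *
      (if successes x = i then 1 else 0) ≤ 1 / √(n * (q * (1 - q))) := fun i => by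
    rw [le_div_iff₀ hsq]
    refine (le_abs_self _).trans ((sq_le_one_iff_abs_le_one _).1 ?_)
    rw [mul_pow, Real.sq_sqrt hv.le, mul_comm]
    exact mul_sq_binomial_atom_le h0 h1 i
  calc _ ≤ ∑ x : Fin n → Bool, ∑ i ∈ Finset.Icc ⌈c - t⌉ ⌊c + t⌋,
        (∏ j, bernMass q (x j)) * (if successes x = i then 1 else 0) := by
        refine Finset.sum_le_sum fun x _ => ?_
        rw [← Finset.mul_sum]
        refine mul_le_mul_of_nonneg_left ?_ (hW x)
        rw [Finset.sum_ite_eq]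
        by_cases h : |(successes x : ℝ) - c| ≤ t
        · have h' := abs_le.1 h
          rw [if_pos h, if_pos]
          rw [Finset.mem_Icc, Int.ceil_le, Int.le_floor]
          constructor <;> linarith
        · rw [if_neg h]; split_ifs <;> norm_num
    _ = ∑ i ∈ Finset.Icc ⌈c - t⌉ ⌊c + t⌋, ∑ x : Fin n → Bool,
        (∏ j, bernMass q (x j)) * (if successes x = i then 1 else 0) := Finset.sum_comm
    _ ≤ ∑ i ∈ Finset.Icc ⌈c - t⌉ ⌊c + t⌋, 1 / √(n * (q * (1 - q))) :=
        Finset.sum_le_sum fun i _ => hatom i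
    _ ≤ _ := by
        rw [Finset.sum_const, nsmul_eq_mul, mul_one_div]
        gcongr
        -- An interval of length `2t` contains at most `2t + 1` integers; the second case below is
        -- that of an empty interval.
        rw [Int.card_Icc]
        have e1 := Int.floor_le (c + t)
        have e2 := Int.le_ceil (c - t)
        rcases le_total 0 (⌊c + t⌋ + 1 - ⌈c - t⌉) with h | h
        · have : (((⌊c + t⌋ + 1 - ⌈c - t⌉).toNat : ℤ) : ℝ) = ⌊c + t⌋ + 1 - ⌈c - t⌉ := by
            rw [Int.toNat_of_nonneg h]; push_cast; ring
          rw [← Int.cast_natCast, this]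
          linarith
        · rw [Int.toNat_of_nonpos h]
          push_cast; linarith

end SmallBall

/-! ### The column sum test for fixed dimension. -/

section SumTest

variable {d n : ℕ}

theorem sum_pairMass_mul_dev_sub_sq {q ρ s : ℝ} (hs : s ^ 2 = 1) (hsρ : s * ρ = |ρ|) :
    ∑ c, pairMass q ρ c * ((dev q c.1 - s * dev q c.2) * (dev q c.1 - s * dev q c.2)) =
      2 * (q * (1 - q)) * (1 - |ρ|) := by
  have : ∀ c, pairMass q ρ c * ((dev q c.1 - s * dev q c.2) * (dev q c.1 - s * dev q c.2)) =
      pairMass q ρ c * (dev q c.1 * dev q c.1) +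
      s ^ 2 * (pairMass q ρ c * (dev q c.2 * dev q c.2)) -
      2 * s * (pairMass q ρ c * (dev q c.1 * dev q c.2)) := fun c => by ring
  simp only [this, Finset.sum_add_distrib, Finset.sum_sub_distrib, ← Finset.mul_sum,
    sum_pairMass_mul_dev_fst_fst, sum_pairMass_mul_dev_snd_snd, sum_pairMass_mul_dev_fst_snd, hs]
  rw [← hsρ]
  ring

/-- The difference of the centred sums of the `X`s and of the `Y`s in one coordinate, the latter
with a sign. -/
noncomputable def sumDiff (q s : ℝ) (k : Fin d) (z : Data d n n) : ℝ :=
  ∑ j, dev q (z.1 j k) - s * ∑ j, dev q (z.2 j k)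

/-- With equally many `X`s and `Y`s the injection is a bijection, so the difference is a sum over
matched pairs, whatever the matching. -/
theorem sum_altMassGiven_mul_sumDiff_sq {q ρ s : ℝ} (hs : s ^ 2 = 1) (hsρ : s * ρ = |ρ|)
    (k : Fin d) (π : Fin n ↪ Fin n) :
    ∑ z, altMassGiven q ρ π z * sumDiff q s k z ^ 2 = n * (2 * (q * (1 - q)) * (1 - |ρ|)) := by
  have hw : ∑ ω : Fin n → Bool × Bool, ∏ j, pairMass q ρ (ω j) = 1 :=
    sum_prod_eq_one (sum_pairMass q ρ)
  have hπ : Function.Bijective π := Finite.injective_iff_bijective.1 π.injective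
  let u : Fin n → Bool × Bool → ℝ := fun _ c => dev q c.1 - s * dev q c.2
  have hu : ∀ j, ∑ c, pairMass q ρ c * u j c = 0 := fun j => by
    simp only [u, mul_sub, mul_left_comm _ s, Finset.sum_sub_distrib, ← Finset.mul_sum,
      sum_pairMass_mul_dev_fst, sum_pairMass_mul_dev_snd, mul_zero, sub_zero]
  have hobs : ∀ ω : Fin d → Fin n → Bool × Bool, sumDiff q s k (observe π ω) =
      ∑ j, u j (ω k j) := fun ω => by
    simp only [sumDiff, observe, u, Finset.sum_sub_distrib, ← Finset.mul_sum]
    rw [hπ.sum_comp fun j => dev q (ω k j).2]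
  rw [sum_altMassGiven_mul]
  simp only [hobs]
  refine (sum_prod_mul_apply hw k fun c : Fin n → Bool × Bool => (∑ j, u j (c j)) ^ 2).trans ?_
  simp only [sq]
  refine (sum_prod_mul_sum_mul_sum (sum_pairMass q ρ) u u hu).trans ?_
  simp only [u, sum_pairMass_mul_dev_sub_sq hs hsρ]
  rw [Finset.sum_const, Finset.card_univ, Fintype.card_fin, nsmul_eq_mul]

theorem sum_nullMass_coordinate (q : ℝ) (k : Fin d) (F : (Fin n → Bool) → (Fin n → Bool) → ℝ) :
    ∑ z : Data d n n, nullMass q z * F (fun j => z.1 j k) (fun j => z.2 j k) =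
      ∑ y : Fin n → Bool, (∏ j, bernMass q (y j)) *
        ∑ x : Fin n → Bool, (∏ j, bernMass q (x j)) * F x y := by
  have hw : ∑ ω : Fin n → Bool × Bool, ∏ j, pairMass q 0 (ω j) = 1 :=
    sum_prod_eq_one (sum_pairMass q 0)
  simp only [nullMass_eq_altMassGiven q (Function.Embedding.refl (Fin n))]
  rw [sum_altMassGiven_mul q 0 (Function.Embedding.refl (Fin n))
    fun z : Data d n n => F (fun j => z.1 j k) (fun j => z.2 j k)]
  refine (sum_prod_mul_apply hw k fun c : Fin n → Bool × Bool =>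
    F (fun j => (c j).1) (fun j => (c j).2)).trans ?_
  rw [← (Equiv.arrowProdEquivProdArrow (Fin n) (fun _ => Bool) (fun _ => Bool)).symm.sum_comp,
    Fintype.sum_prod_type_right]
  refine Finset.sum_congr rfl fun y _ => ?_
  rw [Finset.mul_sum]
  refine Finset.sum_congr rfl fun x _ => ?_
  simp only [Equiv.arrowProdEquivProdArrow, Equiv.coe_fn_symm_mk, pairMass_zero,
    Finset.prod_mul_distrib]
  ring

theorem exists_sum_test {m : ℕ} {q ρ t : ℝ} (h : Admissible q ρ) (hmn : m = n) (hd : 1 ≤ d)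
    (ht : 0 < t) (hv : 0 < n * (q * (1 - q))) (hρ1 : |ρ| ≤ 1) :
    ∃ T : Finset (Data d n m),
      ∑ z ∈ T, nullMass q z ≤ (2 * t + 1) / √(n * (q * (1 - q))) ∧
      ∑ z ∈ Tᶜ, altMass q ρ z ≤ 2 * (n * (q * (1 - q))) * (1 - |ρ|) / t ^ 2 := by
  classical
  subst hmn
  let k : Fin d := ⟨0, hd⟩
  obtain ⟨s, hs, hsρ⟩ : ∃ s : ℝ, s ^ 2 = 1 ∧ s * ρ = |ρ| := by
    rcases le_total 0 ρ with h0 | h0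
    · exact ⟨1, by norm_num, by rw [abs_of_nonneg h0, one_mul]⟩
    · exact ⟨-1, by norm_num, by rw [abs_of_nonpos h0, neg_one_mul]⟩
  refine ⟨Finset.univ.filter fun z => |sumDiff q s k z| ≤ t, ?_, ?_⟩
  · rw [Finset.sum_filter]
    have h1 := sum_nullMass_coordinate (d := d) (n := m) q k fun x y =>
      if |(successes x : ℝ) - (m * q + s * ∑ j, dev q (y j))| ≤ t then 1 else 0
    have h2 : ∀ z : Data d m m, (if |sumDiff q s k z| ≤ t then nullMass q z else 0) =
        nullMass q z * if |(successes (fun j => z.1 j k) : ℝ) -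
          (m * q + s * ∑ j, dev q (z.2 j k))| ≤ t then 1 else 0 := fun z => by
      rw [mul_ite, mul_one, mul_zero, sumDiff, sum_dev q fun j => z.1 j k, sub_sub]
    simp only [h2]
    rw [h1]
    -- With the `Y`s held fixed, the test asks the `X` sum to hit an interval of radius `t`; the
    -- bound does not depend on its centre.
    calc _ ≤ ∑ y : Fin m → Bool, (∏ j, bernMass q (y j)) *
          ((2 * t + 1) / √(m * (q * (1 - q)))) := by
          refine Finset.sum_le_sum fun y _ => mul_le_mul_of_nonneg_left ?_
            (Finset.prod_nonneg fun j _ => bernMass_nonneg h.1 h.2.1 _)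
          exact sum_bernMass_ball_le h.1 h.2.1 ht.le _ hv
      _ = _ := by rw [← Finset.sum_mul, sum_prod_eq_one (sum_bernMass q), one_mul]
  · have hb : 0 ≤ 2 * (m * (q * (1 - q))) * (1 - |ρ|) / t ^ 2 :=
      div_nonneg (mul_nonneg (by positivity) (by linarith)) (sq_nonneg _)
    refine sum_altMass_le hb fun π => ?_
    refine sum_le_of_sq_le (altMassGiven_nonneg h π) ht (fun z hz => ?_)
      ((sum_altMassGiven_mul_sumDiff_sq hs hsρ k π).trans (by ring)).le
    simp only [Finset.mem_compl, Finset.mem_filter, Finset.mem_univ, true_and, not_le] at hz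
    exact hz.le

theorem abs_le_one_of_admissible {q ρ : ℝ} (h : Admissible q ρ) (hq : q ≤ 1 / 2) : |ρ| ≤ 1 := by
  have h1 : q / (1 - q) ≤ 1 := div_le_one_of_le₀ (by linarith) (by linarith)
  have h2 := h.2.2.1
  have h3 := min_le_left (q / (1 - q)) ((1 - q) / q)
  exact abs_le.2 ⟨by linarith, h.2.2.2⟩

theorem strongDetection_of_tendsto_one (hd : 1 ≤ d) {n m : ℕ → ℕ} (hmn : ∀ k, m k = n k)
    {q ρ : ℕ → ℝ} (h : ∀ k, Admissible (q k) (ρ k)) (hq : ∀ k, q k ≤ 1 / 2)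
    (h1 : Tendsto (fun k => ρ k ^ 2) atTop (𝓝 1))
    (h2 : Tendsto (fun k => (n k : ℝ) * q k) atTop atTop) :
    StrongDetection (fun k => bernoulliModel d (q k) (ρ k)) n m := by
  refine (strongDetection_iff (d := fun _ => d) h fun k => (hmn k).le).2 ?_
  intro δ hδ
  have hlim1 : Tendsto (fun k => 2 * (1 - |ρ k|) / (δ / 4) ^ 2) atTop
      (𝓝 (2 * (1 - 1) / (δ / 4) ^ 2)) := by
    have : Tendsto (fun k => |ρ k|) atTop (𝓝 1) := by
      have := (Real.continuous_sqrt.tendsto 1).comp h1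
      simpa [Function.comp_def, Real.sqrt_sq_eq_abs] using this
    exact ((this.const_sub 1).const_mul 2).div_const _
  filter_upwards [hlim1.eventually_lt_const (u := δ) (by simpa using hδ),
    h2.eventually_ge_atTop (2 * (4 / δ) ^ 2)] with k hk1 hk2
  have hv : q k / 2 ≤ q k * (1 - q k) := by nlinarith [hq k, (h k).1]
  have hv1 : (4 / δ) ^ 2 ≤ n k * (q k * (1 - q k)) := by
    have : (n k : ℝ) * (q k / 2) ≤ n k * (q k * (1 - q k)) := by gcongr
    linarith
  have hv0 : 0 < n k * (q k * (1 - q k)) := lt_of_lt_of_le (by positivity) hv1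
  have hs0 := Real.sqrt_pos.2 hv0
  have hs1 : 4 / δ ≤ √(n k * (q k * (1 - q k))) := Real.le_sqrt_of_sq_le hv1
  -- A radius of `δ / 4` standard deviations makes the null error at most `δ / 2 + 1 / √(n v) ≤ 3 δ
  -- / 4`, and the other error `2 (1 - |ρ|) / (δ / 4)²`, which tends to zero.
  obtain ⟨T, hT1, hT2⟩ := exists_sum_test (d := d) (t := δ / 4 * √(n k * (q k * (1 - q k))))
    (h k) (hmn k) hd (by positivity) hv0 (abs_le_one_of_admissible (h k) (hq k))
  refine ⟨T, hT1.trans_lt ?_, hT2.trans_lt (lt_of_eq_of_lt ?_ hk1)⟩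
  · rw [div_lt_iff₀ hs0]
    have : 4 ≤ δ * √(n k * (q k * (1 - q k))) := by
      rw [div_le_iff₀ hδ] at hs1; linarith
    nlinarith
  · rw [mul_pow, Real.sq_sqrt hv0.le]
    generalize (n k : ℝ) * (q k * (1 - q k)) = v at hv0
    field_simp

end SumTest

/-! ### Walsh expansion of the likelihood ratio. -/

section Orthonormal

variable {d n m : ℕ}

/-- The standardized value of a Bernoulli variable. -/
noncomputable def stdDev (q : ℝ) (b : Bool) : ℝ := dev q b / √(q * (1 - q))

/-- The product of the standardized values of the coordinates in `S`. -/
noncomputable def walsh (q : ℝ) (S : Finset (Fin d)) (x : Fin d → Bool) : ℝ :=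
  ∏ k ∈ S, stdDev q (x k)

theorem sum_bernMass_mul_stdDev (q : ℝ) : ∑ b, bernMass q b * stdDev q b = 0 := by
  simp only [stdDev, mul_div_assoc', ← Finset.sum_div, sum_bernMass_mul_dev, zero_div]

theorem stdDev_mul_stdDev {q : ℝ} (h0 : 0 ≤ q) (h1 : q ≤ 1) (a b : Bool) :
    stdDev q a * stdDev q b = dev q a * dev q b / (q * (1 - q)) := by
  rw [stdDev, stdDev, div_mul_div_comm, Real.mul_self_sqrt (mul_nonneg h0 (by linarith))]

theorem sum_bernMass_mul_stdDev_sq {q : ℝ} (h0 : 0 ≤ q) (h1 : q ≤ 1) :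
    ∑ b, bernMass q b * (stdDev q b * stdDev q b) ≤ 1 := by
  simp only [stdDev_mul_stdDev h0 h1, mul_div_assoc', ← Finset.sum_div, sum_bernMass_mul_dev_dev]
  exact div_self_le_one _

theorem pairMass_eq {q ρ : ℝ} (h0 : 0 ≤ q) (h1 : q ≤ 1) (a b : Bool) :
    pairMass q ρ (a, b) =
      bernMass q a * bernMass q b * (1 + ρ * (stdDev q a * stdDev q b)) := by
  rw [stdDev_mul_stdDev h0 h1]
  -- For `q = 0` or `q = 1` division by zero makes `stdDev` vanish, and the pair law is indeed the
  -- product law.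
  rcases h0.eq_or_lt with rfl | h0
  · cases a <;> cases b <;> simp [pairMass, bernMass]
  rcases h1.eq_or_lt with rfl | h1
  · cases a <;> cases b <;> simp [pairMass, bernMass]
  have h2 : 1 - q ≠ 0 := by linarith
  cases a <;> cases b <;> 
    simp only [pairMass, bernMass, dev, if_true, Bool.false_eq_true, if_false] <;>
    field_simp <;> ring

theorem vecPairMass_eq {q ρ : ℝ} (h0 : 0 ≤ q) (h1 : q ≤ 1) (x y : Fin d → Bool) :
    vecPairMass q ρ x y = vecMass q x * vecMass q y *
      ∑ S : Finset (Fin d), ρ ^ S.card * (walsh q S x * walsh q S y) := by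
  simp only [vecPairMass, vecMass, pairMass_eq h0 h1, Finset.prod_mul_distrib]
  congr 1
  rw [Finset.prod_one_add, Finset.powerset_univ]
  refine Finset.sum_congr rfl fun S _ => ?_
  simp only [walsh, Finset.prod_mul_distrib, Finset.prod_const]

theorem sum_vecMass_mul_walsh (q : ℝ) (S S' : Finset (Fin d)) :
    ∑ x : Fin d → Bool, vecMass q x * (walsh q S x * walsh q S' x) =
      ∏ k, ∑ b, bernMass q b *
        ((if k ∈ S then stdDev q b else 1) * if k ∈ S' then stdDev q b else 1) := by
  rw [← sum_prod_mul_prod]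
  refine Finset.sum_congr rfl fun x _ => ?_
  rw [vecMass, Finset.prod_mul_distrib]
  simp [walsh]

theorem sum_vecMass_mul_walsh_of_ne (q : ℝ) {S S' : Finset (Fin d)} (h : S ≠ S') :
    ∑ x : Fin d → Bool, vecMass q x * (walsh q S x * walsh q S' x) = 0 := by
  rw [sum_vecMass_mul_walsh]
  obtain ⟨k, hk⟩ : ∃ k, ¬ (k ∈ S ↔ k ∈ S') := by
    by_contra! h'
    exact h (Finset.ext h')
  refine Finset.prod_eq_zero (Finset.mem_univ k) ?_
  by_cases h1 : k ∈ S
  · have h2 : k ∉ S' := fun h2 => hk (by simp [h1, h2])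
    simp only [h1, h2, if_true, if_false, mul_one, sum_bernMass_mul_stdDev]
  · have h2 : k ∈ S' := by
      by_contra h2
      exact hk (by simp [h1, h2])
    simp only [h1, h2, if_true, if_false, one_mul, sum_bernMass_mul_stdDev]

theorem sum_vecMass_mul_walsh_self_le {q : ℝ} (h0 : 0 ≤ q) (h1 : q ≤ 1) (S : Finset (Fin d)) :
    ∑ x : Fin d → Bool, vecMass q x * (walsh q S x * walsh q S x) ≤ 1 := by
  rw [sum_vecMass_mul_walsh]
  refine Finset.prod_le_one (fun k _ => Finset.sum_nonneg fun b _ =>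
    mul_nonneg (bernMass_nonneg h0 h1 b) (mul_self_nonneg _)) fun k _ => ?_
  by_cases h : k ∈ S
  · simp only [h, if_true]
    exact sum_bernMass_mul_stdDev_sq h0 h1
  · simp only [h, if_false, mul_one]
    exact (sum_bernMass q).le

/-- The likelihood ratio of the two hypotheses. -/
noncomputable def likelihoodRatio (q ρ : ℝ) (z : Data d n m) : ℝ :=
  (Fintype.card (Fin m ↪ Fin n) : ℝ)⁻¹ * ∑ π : Fin m ↪ Fin n,
    ∏ i, ∑ S : Finset (Fin d), ρ ^ S.card * (walsh q S (z.1 (π i)) * walsh q S (z.2 i))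

theorem altMass_eq_mul {q ρ : ℝ} (h0 : 0 ≤ q) (h1 : q ≤ 1) (z : Data d n m) :
    altMass q ρ z = nullMass q z * likelihoodRatio q ρ z := by
  rw [altMass, likelihoodRatio, mul_left_comm (nullMass q z)]
  congr 1
  rw [Finset.mul_sum]
  refine Finset.sum_congr rfl fun π _ => ?_
  simp only [altMassGiven, nullMass, vecPairMass_eq h0 h1, Finset.prod_mul_distrib]
  rw [← prod_injection_mul_prod_compl π]
  ring

theorem sum_nullMass_mul_likelihoodRatio_sq_le {q ρ : ℝ} (h0 : 0 ≤ q) (h1 : q ≤ 1) (hmn : m ≤ n)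
    (hn : 0 < n)
    (hρ : ∀ S : Finset (Fin d), S ≠ ∅ → (m : ℝ) / n * (ρ ^ S.card) ^ 2 < 1) :
    ∑ z : Data d n m, nullMass q z * likelihoodRatio q ρ z ^ 2 ≤
      ∏ S : {S : Finset (Fin d) // S ≠ ∅}, (1 - (m : ℝ) / n * (ρ ^ S.1.card) ^ 2)⁻¹ :=
  second_moment_le hmn hn ∅ (vecMass q) (vecMass_nonneg h0 h1) (walsh q)
    (fun S => ρ ^ S.card) (fun x => by simp [walsh]) (by simp) hρ
    (fun _ _ h => sum_vecMass_mul_walsh_of_ne q h) (sum_vecMass_mul_walsh_self_le h0 h1)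

theorem sum_altMassGiven (q ρ : ℝ) (π : Fin m ↪ Fin n) :
    ∑ z : Data d n m, altMassGiven q ρ π z = 1 := by
  have h := sum_altMassGiven_mul (d := d) q ρ π fun _ => 1
  simp only [mul_one] at h
  rw [h]
  exact sum_prod_eq_one (w := fun c : Fin n → Bool × Bool => ∏ j, pairMass q ρ (c j))
    (sum_prod_eq_one (sum_pairMass q ρ))

theorem sum_altMass (q ρ : ℝ) (hmn : m ≤ n) : ∑ z : Data d n m, altMass q ρ z = 1 := by
  have hne : Nonempty (Fin m ↪ Fin n) := ⟨Fin.castLEEmb hmn⟩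
  have hc : (Fintype.card (Fin m ↪ Fin n) : ℝ) ≠ 0 := by exact_mod_cast Fintype.card_ne_zero
  simp only [altMass]
  rw [← Finset.mul_sum, Finset.sum_comm]
  simp only [sum_altMassGiven]
  rw [Finset.sum_const, nsmul_eq_mul, Finset.card_univ, mul_one, inv_mul_cancel₀ hc]

/-- A bounded second moment prevents the alternative from concentrating on a set of small null
probability. -/
theorem not_exists_test_of_second_moment {q ρ C δ : ℝ} (h0 : 0 ≤ q) (h1 : q ≤ 1) (hmn : m ≤ n)
    (hC : 0 < C) (hδ : 4 * δ * (1 + C) ≤ 1)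
    (hL : ∑ z : Data d n m, nullMass q z * likelihoodRatio q ρ z ^ 2 ≤ C) :
    ¬ ∃ T : Finset (Data d n m),
        ∑ z ∈ T, nullMass q z < δ ∧ ∑ z ∈ Tᶜ, altMass q ρ z < δ := by
  rintro ⟨T, hT1, hT2⟩
  have hA := sum_altMass (d := d) q ρ hmn
  rw [← Finset.sum_add_sum_compl T] at hA
  have hC' : ∑ z ∈ T, nullMass q z * likelihoodRatio q ρ z ^ 2 ≤ C :=
    (Finset.sum_le_univ_sum_of_nonneg fun z => mul_nonneg (nullMass_nonneg h0 h1 z)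
      (sq_nonneg _)).trans hL
  -- Cauchy–Schwarz in linearized form. The shift `2C` yields `alt(T) ≤ 1/4 + C null(T)`,
  -- incompatible with `alt(T) > 1 - δ` and `δ (1 + C) ≤ 1/4`.
  have hsq : 0 ≤ ∑ z ∈ T, nullMass q z * (likelihoodRatio q ρ z - 2 * C) ^ 2 :=
    Finset.sum_nonneg fun z _ => mul_nonneg (nullMass_nonneg h0 h1 z) (sq_nonneg _)
  have hexp : ∀ z : Data d n m, nullMass q z * (likelihoodRatio q ρ z - 2 * C) ^ 2 =
      nullMass q z * likelihoodRatio q ρ z ^ 2 - 4 * C * altMass q ρ z +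
        4 * C ^ 2 * nullMass q z := fun z => by
    rw [altMass_eq_mul h0 h1]; ring
  simp only [hexp, Finset.sum_add_distrib, Finset.sum_sub_distrib, ← Finset.mul_sum] at hsq
  nlinarith [mul_lt_mul_of_pos_left hT1 (mul_pos hC hC), mul_lt_mul_of_pos_left hT2 hC]

end Orthonormal

/-! ### Truncation to data without common successes. -/

section Truncation

variable {d n m : ℕ}

open Classical in
/-- The data sets without a common success in a pair matched by the injection. -/
noncomputable def disjointData (d : ℕ) (π : Fin m ↪ Fin n) : Finset (Data d n m) :=
  Finset.univ.filter fun z => ∀ k i, ¬ (z.1 (π i) k = true ∧ z.2 i k = true)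

theorem sum_disjointData (q ρ : ℝ) (π : Fin m ↪ Fin n) :
    ∑ z ∈ disjointData d π, altMassGiven q ρ π z = (1 - pairMass q ρ (true, true)) ^ (d * m) := by
  classical
  let G : Fin n → Bool × Bool → ℝ := fun j c =>
    if j ∈ Finset.univ.map π then (if c.1 = true ∧ c.2 = true then 0 else 1) else 1
  have hG : ∀ z : Data d n m, (if ∀ k i, ¬ (z.1 (π i) k = true ∧ z.2 i k = true) then
      altMassGiven q ρ π z else 0) = altMassGiven q ρ π z *
      if ∀ k i, ¬ (z.1 (π i) k = true ∧ z.2 i k = true) then 1 else 0 := fun z => by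
    rw [mul_ite, mul_one, mul_zero]
  have hobs : ∀ ω : Fin d → Fin n → Bool × Bool,
      (if ∀ k i, ¬ ((observe π ω).1 (π i) k = true ∧ (observe π ω).2 i k = true) then
        (1 : ℝ) else 0) = ∏ k, ∏ j, G j (ω k j) := fun ω => by
    have : ∀ k, ∏ j, G j (ω k j) =
        if ∀ i, ¬ ((ω k (π i)).1 = true ∧ (ω k (π i)).2 = true) then 1 else 0 := fun k => by
      simp only [G]
      rw [← Finset.prod_filter, Finset.filter_mem_eq_inter, Finset.univ_inter, Finset.prod_map]
      simp only [← ite_not (p := _ ∧ _), Finset.prod_boole, Finset.mem_univ, true_imp_iff]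
    simp only [this, Finset.prod_boole, Finset.mem_univ, true_imp_iff, observe]
    congr
  rw [disjointData, Finset.sum_filter]
  simp only [hG]
  rw [sum_altMassGiven_mul q ρ π fun z : Data d n m =>
    if ∀ k i, ¬ (z.1 (π i) k = true ∧ z.2 i k = true) then 1 else 0]
  simp only [hobs]
  rw [sum_prod_mul_prod (fun c : Fin n → Bool × Bool => ∏ j, pairMass q ρ (c j))
    fun _ c => ∏ j, G j (c j)]
  simp only [sum_prod_mul_prod (pairMass q ρ) G]
  have hs : ∀ j, ∑ c, pairMass q ρ c * G j c =
      if j ∈ Finset.univ.map π then 1 - pairMass q ρ (true, true) else 1 := fun j => by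
    simp only [G]
    split_ifs
    · have := sum_pairMass q ρ
      simp [Fintype.sum_prod_type] at this ⊢
      linarith
    · simp only [mul_one, sum_pairMass]
  simp only [hs]
  rw [← Finset.prod_filter, Finset.filter_mem_eq_inter, Finset.univ_inter, Finset.prod_map]
  simp only [Finset.prod_const, Finset.card_univ, Fintype.card_fin]
  rw [← pow_mul, mul_comm]

/-- Relative to the product law, the mixed cells have density `1 - ρ ≤ 1`, and the cell of two
failures `1 + ρ q / (1 - q)`. Only the excluded cell can have a large density, of order `ρ / q`. -/
theorem pairMass_le {q ρ : ℝ} (h : Admissible q ρ) (hq : q ≤ 1 / 2) (hρ : 0 ≤ ρ) (a b : Bool)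
    (hab : ¬ (a = true ∧ b = true)) :
    pairMass q ρ (a, b) ≤ bernMass q a * bernMass q b * (1 + 2 * ρ * q) := by
  have h0 := h.1
  have h2 : 0 ≤ ρ * q := mul_nonneg hρ h0
  have h3 : 0 ≤ q * (1 - q) := mul_nonneg h0 (by linarith)
  have h4 : q * (1 - q) * (1 - ρ) ≤ q * (1 - q) * (1 + 2 * ρ * q) := by gcongr; linarith
  cases a <;> cases b <;> simp only [pairMass, bernMass, if_true, Bool.false_eq_true, if_false]
  · have h5 : (1 - q + ρ * q) ≤ (1 - q) * (1 + 2 * ρ * q) := by nlinarith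
    calc (1 - q) * (1 - q + ρ * q) ≤ (1 - q) * ((1 - q) * (1 + 2 * ρ * q)) :=
          mul_le_mul_of_nonneg_left h5 (by linarith)
      _ = _ := by ring
  · linarith
  · linarith
  · simp at hab

theorem altMassGiven_le_of_mem_disjointData {q ρ : ℝ} (h : Admissible q ρ) (hq : q ≤ 1 / 2)
    (hρ : 0 ≤ ρ) (π : Fin m ↪ Fin n) {z : Data d n m} (hz : z ∈ disjointData d π) :
    altMassGiven q ρ π z ≤ (1 + 2 * ρ * q) ^ (d * m) * nullMass q z := by
  classical
  have hz' : ∀ k i, ¬ (z.1 (π i) k = true ∧ z.2 i k = true) := (Finset.mem_filter.1 hz).2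
  have h1 : ∏ i, vecPairMass q ρ (z.1 (π i)) (z.2 i) ≤
      ∏ i, (vecMass q (z.1 (π i)) * vecMass q (z.2 i) * (1 + 2 * ρ * q) ^ d) := by
    refine Finset.prod_le_prod (fun i _ => vecPairMass_nonneg h _ _) fun i _ => ?_
    have h2 : ∏ k, pairMass q ρ (z.1 (π i) k, z.2 i k) ≤
        ∏ k, (bernMass q (z.1 (π i) k) * bernMass q (z.2 i k) * (1 + 2 * ρ * q)) :=
      Finset.prod_le_prod (fun k _ => pairMass_nonneg h _)
        fun k _ => pairMass_le h hq hρ _ _ (hz' k i)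
    simpa only [vecPairMass, vecMass, Finset.prod_mul_distrib, Finset.prod_const, Finset.card_univ,
      Fintype.card_fin] using h2
  simp only [Finset.prod_mul_distrib, Finset.prod_const, Finset.card_univ,
    Fintype.card_fin, ← pow_mul] at h1
  rw [altMassGiven, nullMass, ← prod_injection_mul_prod_compl π]
  refine (mul_le_mul_of_nonneg_right h1 (Finset.prod_nonneg fun _ _ =>
    vecMass_nonneg h.1 h.2.1 _)).trans_eq ?_
  ring

/-- Without common successes the alternative given `π` is dominated by a multiple of the null; the
rest of `T` is charged to the probability of a common success. Neither bound depends on `π`, so both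
pass to the mixture. -/
theorem sum_altMass_le_of_truncation {q ρ : ℝ} (h : Admissible q ρ) (hq : q ≤ 1 / 2)
    (hρ : 0 ≤ ρ) (T : Finset (Data d n m)) :
    ∑ z ∈ T, altMass q ρ z ≤ (1 + 2 * ρ * q) ^ (d * m) * ∑ z ∈ T, nullMass q z +
      (1 - (1 - pairMass q ρ (true, true)) ^ (d * m)) := by
  classical
  have h0 := h.1
  have hr0 := pairMass_nonneg h (true, true)
  have hr1 : pairMass q ρ (true, true) ≤ 1 := by
    rw [← sum_pairMass q ρ]
    exact Finset.single_le_sum (fun c _ => pairMass_nonneg h c) (Finset.mem_univ _)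
  have hN : ∀ S : Finset (Data d n m), 0 ≤ ∑ z ∈ S, nullMass q z :=
    fun S => Finset.sum_nonneg fun z _ => nullMass_nonneg h.1 h.2.1 z
  refine sum_altMass_le ?_ fun π => ?_
  · have : (1 - pairMass q ρ (true, true)) ^ (d * m) ≤ 1 :=
      pow_le_one₀ (by linarith) (by linarith)
    have := mul_nonneg (pow_nonneg (show 0 ≤ 1 + 2 * ρ * q by positivity) (d * m)) (hN T)
    linarith
  · have e1 := sum_altMassGiven (d := d) q ρ π
    rw [← Finset.sum_add_sum_compl (disjointData d π), sum_disjointData] at e1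
    have e2 : ∑ z ∈ T ∩ disjointData d π, altMassGiven q ρ π z ≤
        (1 + 2 * ρ * q) ^ (d * m) * ∑ z ∈ T, nullMass q z := by
      calc _ ≤ ∑ z ∈ T ∩ disjointData d π, (1 + 2 * ρ * q) ^ (d * m) * nullMass q z :=
            Finset.sum_le_sum fun z hz => altMassGiven_le_of_mem_disjointData h hq hρ π
              (Finset.mem_inter.1 hz).2
        _ ≤ _ := by
            rw [← Finset.mul_sum]
            refine mul_le_mul_of_nonneg_left ?_ (by positivity)
            exact Finset.sum_le_sum_of_subset_of_nonneg Finset.inter_subset_left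
              fun z _ _ => nullMass_nonneg h.1 h.2.1 z
    have e3 : ∑ z ∈ T \ disjointData d π, altMassGiven q ρ π z ≤
        ∑ z ∈ (disjointData d π)ᶜ, altMassGiven q ρ π z :=
      Finset.sum_le_sum_of_subset_of_nonneg (fun z hz => by
        simpa using (Finset.mem_sdiff.1 hz).2) fun z _ _ => altMassGiven_nonneg h π z
    rw [← Finset.sum_inter_add_sum_sdiff T (disjointData d π)]
    linarith

end Truncation

/-! ### Necessity of the conditions. -/

theorem one_le_one_sub_mul_exp {x : ℝ} (h0 : 0 ≤ x) (h1 : x ≤ 1 / 2) :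
    1 ≤ (1 - x) * Real.exp (2 * x) := by
  have h2 := Real.add_one_le_exp (2 * x)
  nlinarith [mul_le_mul_of_nonneg_left h2 (show 0 ≤ 1 - x by linarith)]

theorem eventually_second_moment_unbounded {d n m : ℕ → ℕ} {q ρ : ℕ → ℝ}
    (h : ∀ k, Admissible (q k) (ρ k)) (hmn : ∀ k, m k ≤ n k) (hn : Tendsto n atTop atTop)
    (hSD : StrongDetection (fun k => bernoulliModel (d k) (q k) (ρ k)) n m)
    {C : ℝ} (hC : 0 < C) :
    ∀ᶠ k in atTop, ¬ ((∀ S : Finset (Fin (d k)), S ≠ ∅ →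
        (m k : ℝ) / n k * (ρ k ^ S.card) ^ 2 < 1) ∧
      ∏ S : {S : Finset (Fin (d k)) // S ≠ ∅},
        (1 - (m k : ℝ) / n k * (ρ k ^ S.1.card) ^ 2)⁻¹ ≤ C) := by
  have hδ : 0 < 1 / (4 * (1 + C)) := by positivity
  filter_upwards [(strongDetection_iff h hmn).1 hSD _ hδ, hn.eventually_gt_atTop 0]
    with k hT hn0 ⟨hρ, hprod⟩
  refine not_exists_test_of_second_moment (h k).1 (h k).2.1 (hmn k) hC (le_of_eq ?_)
    ((sum_nullMass_mul_likelihoodRatio_sq_le (h k).1 (h k).2.1 (hmn k) hn0 hρ).trans hprod) hT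
  field_simp

theorem eventually_lt_ratio_mul_sq {d : ℕ} {n m : ℕ → ℕ} {q ρ : ℕ → ℝ}
    (h : ∀ k, Admissible (q k) (ρ k)) (hρ : ∀ k, |ρ k| ≤ 1) (hmn : ∀ k, m k ≤ n k)
    (hn : Tendsto n atTop atTop)
    (hSD : StrongDetection (fun k => bernoulliModel d (q k) (ρ k)) n m)
    {c : ℝ} (hc : c < 1) :
    ∀ᶠ k in atTop, c < (m k : ℝ) / n k * ρ k ^ 2 := by
  have hc1 : 0 < 1 - c := by linarith
  -- Each factor is at most `(1 - c)⁻¹`, and for fixed `d` the number of factors is constant.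
  filter_upwards [eventually_second_moment_unbounded (d := fun _ => d) h hmn hn hSD
    (C := ((1 - c)⁻¹) ^ Fintype.card {S : Finset (Fin d) // S ≠ ∅}) (by positivity)] with k hk
  by_contra! hle
  have hS : ∀ S : Finset (Fin d), S ≠ ∅ → (m k : ℝ) / n k * (ρ k ^ S.card) ^ 2 ≤ c := by
    intro S hS
    refine le_trans ?_ hle
    have h1 : (ρ k ^ S.card) ^ 2 ≤ ρ k ^ 2 := by
      rw [← pow_mul, mul_comm, pow_mul]
      exact pow_le_of_le_one (sq_nonneg _) ((sq_le_one_iff_abs_le_one _).2 (hρ k))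
        (Finset.card_ne_zero.2 (Finset.nonempty_iff_ne_empty.2 hS))
    gcongr
  refine hk ⟨fun S hS' => (hS S hS').trans_lt hc, ?_⟩
  rw [← Finset.card_univ, ← Finset.prod_const]
  refine Finset.prod_le_prod (fun S _ => inv_nonneg.2 ?_) fun S _ => ?_
  · linarith [hS S S.2]
  · exact inv_anti₀ hc1 (by linarith [hS S S.2])

theorem tendsto_sq_one_and_eq_one {d : ℕ} {α : ℝ} (hα0 : 0 < α) (hα1 : α ≤ 1) {n : ℕ → ℕ}
    {q ρ : ℕ → ℝ} (h : ∀ k, Admissible (q k) (ρ k)) (hρ : ∀ k, |ρ k| ≤ 1)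
    (hn : Tendsto n atTop atTop)
    (hSD : StrongDetection (fun k => bernoulliModel d (q k) (ρ k)) n
      (fun k => ⌊α * (n k : ℝ)⌋₊)) :
    α = 1 ∧ Tendsto (fun k => ρ k ^ 2) atTop (𝓝 1) := by
  have key := fun (c : ℝ) (hc : c < 1) => eventually_lt_ratio_mul_sq h hρ
    (fun k => floor_mul_le hα1 (n k)) hn hSD hc
  have hβ : ∀ k, (⌊α * (n k : ℝ)⌋₊ : ℝ) / n k ≤ α := fun k =>
    div_le_of_le_mul₀ (Nat.cast_nonneg _) hα0.le (Nat.floor_le (by positivity))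
  have hρ2 : ∀ k, ρ k ^ 2 ≤ 1 := fun k => (sq_le_one_iff_abs_le_one _).2 (hρ k)
  constructor
  · by_contra hne
    obtain ⟨k, hk⟩ := (key α (lt_of_le_of_ne hα1 hne)).exists
    have : (⌊α * (n k : ℝ)⌋₊ : ℝ) / n k * ρ k ^ 2 ≤ α * 1 :=
      mul_le_mul (hβ k) (hρ2 k) (sq_nonneg _) hα0.le
    linarith
  · refine tendsto_order.2 ⟨fun c hc => ?_, fun c hc => Eventually.of_forall fun k =>
      (hρ2 k).trans_lt hc⟩
    filter_upwards [key c hc] with k hk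
    have : (⌊α * (n k : ℝ)⌋₊ : ℝ) / n k * ρ k ^ 2 ≤ 1 * ρ k ^ 2 := by
      gcongr; exact (hβ k).trans hα1
    linarith

theorem tendsto_sq_mul_atTop {d n m : ℕ → ℕ} {q ρ : ℕ → ℝ}
    (h : ∀ k, Admissible (q k) (ρ k)) (hmn : ∀ k, m k ≤ n k)
    (hn : Tendsto n atTop atTop) (hd : Tendsto d atTop atTop)
    (hSD : StrongDetection (fun k => bernoulliModel (d k) (q k) (ρ k)) n m) :
    Tendsto (fun k => ρ k ^ 2 * (d k : ℝ)) atTop atTop := by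
  refine tendsto_atTop.2 fun K => ?_
  have hd' : Tendsto (fun k => (d k : ℝ)) atTop atTop := tendsto_natCast_atTop_atTop.comp hd
  filter_upwards [eventually_second_moment_unbounded h hmn hn hSD
    (C := Real.exp (2 * Real.exp K)) (Real.exp_pos _), hd'.eventually_ge_atTop (2 * K),
    hd'.eventually_gt_atTop 0] with k hk hdK hd0
  by_contra! hle
  -- From `ρ² d < K` and `d ≥ 2K`; this makes `(1 - x)⁻¹ ≤ exp (2x)` available for every factor.
  have hρ : ρ k ^ 2 ≤ 1 / 2 := by nlinarith
  have hρ0 := sq_nonneg (ρ k)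
  have hβ0 : 0 ≤ (m k : ℝ) / n k := by positivity
  have hβ1 : (m k : ℝ) / n k ≤ 1 := div_le_one_of_le₀ (by exact_mod_cast hmn k) (by positivity)
  have hx0 : ∀ S : Finset (Fin (d k)), 0 ≤ (m k : ℝ) / n k * (ρ k ^ S.card) ^ 2 :=
    fun S => by positivity
  have hx1 : ∀ S : Finset (Fin (d k)),
      (m k : ℝ) / n k * (ρ k ^ S.card) ^ 2 ≤ (ρ k ^ 2) ^ S.card := fun S => by
    rw [← pow_mul, mul_comm S.card, pow_mul]
    exact mul_le_of_le_one_left (by positivity) hβ1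
  have hx2 : ∀ S : Finset (Fin (d k)), S ≠ ∅ →
      (m k : ℝ) / n k * (ρ k ^ S.card) ^ 2 ≤ 1 / 2 := fun S hS =>
    (hx1 S).trans ((pow_le_of_le_one hρ0 (by linarith)
      (Finset.card_ne_zero.2 (Finset.nonempty_iff_ne_empty.2 hS))).trans hρ)
  refine hk ⟨fun S hS => (hx2 S hS).trans_lt (by norm_num), ?_⟩
  calc ∏ S : {S : Finset (Fin (d k)) // S ≠ ∅}, (1 - (m k : ℝ) / n k * (ρ k ^ S.1.card) ^ 2)⁻¹
      ≤ ∏ S : {S : Finset (Fin (d k)) // S ≠ ∅}, Real.exp (2 * (ρ k ^ 2) ^ S.1.card) := by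
        refine Finset.prod_le_prod (fun S _ => inv_nonneg.2 (by linarith [hx2 S S.2]))
          fun S _ => ?_
        have h1 : 0 < 1 - (m k : ℝ) / n k * (ρ k ^ S.1.card) ^ 2 := by linarith [hx2 S S.2]
        refine le_trans ?_ (Real.exp_le_exp.2 (mul_le_mul_of_nonneg_left (hx1 S) zero_le_two))
        rw [inv_le_iff_one_le_mul₀' h1]
        exact one_le_one_sub_mul_exp (hx0 S) (hx2 S S.2)
    _ = Real.exp (∑ S : {S : Finset (Fin (d k)) // S ≠ ∅}, 2 * (ρ k ^ 2) ^ S.1.card) :=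
        (Real.exp_sum _ _).symm
    _ ≤ Real.exp (2 * Real.exp K) := by
        refine Real.exp_le_exp.2 ?_
        rw [← Finset.mul_sum]
        refine mul_le_mul_of_nonneg_left ?_ zero_le_two
        -- Adding the empty set completes the binomial expansion of `(1 + ρ²)^d`.
        calc ∑ S : {S : Finset (Fin (d k)) // S ≠ ∅}, (ρ k ^ 2) ^ S.1.card
            ≤ ∑ S : Finset (Fin (d k)), (ρ k ^ 2) ^ S.card := by
              rw [← Finset.sum_subtype (Finset.univ.filter fun S : Finset (Fin (d k)) => S ≠ ∅)
                (by simp) fun S => (ρ k ^ 2) ^ S.card]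
              exact Finset.sum_le_univ_sum_of_nonneg fun S => by positivity
          _ = (1 + ρ k ^ 2) ^ d k := by
              have := Finset.prod_one_add (s := (Finset.univ : Finset (Fin (d k))))
                (f := fun _ => ρ k ^ 2)
              simp only [Finset.prod_const, Finset.card_univ, Fintype.card_fin,
                Finset.powerset_univ] at this
              exact this.symm
          _ ≤ Real.exp (ρ k ^ 2) ^ d k := by
              gcongr
              linarith [Real.add_one_le_exp (ρ k ^ 2)]
          _ = Real.exp (ρ k ^ 2 * d k) := by rw [mul_comm, Real.exp_nat_mul]
          _ ≤ Real.exp K := Real.exp_le_exp.2 hle.le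

/-- This serves both regimes: `ρ² d ≥ 1/2` eventually holds when `ρ² → 1` with `d ≥ 1` fixed as well
as when `ρ² d → ∞`. -/
theorem tendsto_mul_abs_atTop {d n m : ℕ → ℕ} {q ρ : ℕ → ℝ}
    (h : ∀ k, Admissible (q k) (ρ k)) (hq : ∀ k, q k ≤ 1 / 2) (hmn : ∀ k, m k ≤ n k)
    (hn : Tendsto n atTop atTop) (hρ : ∀ᶠ k in atTop, 1 / 2 ≤ ρ k ^ 2 * (d k : ℝ))
    (hSD : StrongDetection (fun k => bernoulliModel (d k) (q k) (ρ k)) n m) :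
    Tendsto (fun k => (n k : ℝ) * (d k : ℝ) * q k * |ρ k|) atTop atTop := by
  refine tendsto_atTop.2 fun M => ?_
  have hn' : Tendsto (fun k => (n k : ℝ)) atTop atTop := tendsto_natCast_atTop_atTop.comp hn
  -- If `n d q ρ < M` with `ρ ≥ 0`, then `K` bounds the truncated likelihood ratio and `s` is a
  -- lower bound for the probability of no common success. The level `s / (K + 1)` is where `1 - δ <
  -- K δ + 1 - s` becomes contradictory.
  set K : ℝ := Real.exp (2 * M)
  set s : ℝ := Real.exp (-(2 * (2 * M ^ 2 + M)))
  have hK : 0 < K := Real.exp_pos _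
  have hs : 0 < s := Real.exp_pos _
  have hδ : 0 < s / (K + 1) := by positivity
  filter_upwards [(strongDetection_iff h hmn).1 hSD _ hδ, hρ, hn'.eventually_ge_atTop 1,
    hn'.eventually_ge_atTop (4 * M)] with k ⟨T, hT1, hT2⟩ hρd hn1 hnM
  by_contra! hlt
  have hq0 := (h k).1
  have hd0 : (0 : ℝ) ≤ d k := Nat.cast_nonneg _
  rcases lt_or_ge (ρ k) 0 with hneg | hpos
  -- Negative correlations are limited by `q / (1 - q) ≤ 2q`, so `n d q |ρ| ≥ n d ρ² / 2 ≥ n / 4 ≥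
  -- M`.
  · have h1 : |ρ k| ≤ 2 * q k := by
      have h2 := (h k).2.2.1
      have h3 := min_le_left (q k / (1 - q k)) ((1 - q k) / q k)
      have h4 : q k / (1 - q k) ≤ 2 * q k := by
        rw [div_le_iff₀ (by linarith [hq k])]
        nlinarith [hq k]
      rw [abs_of_neg hneg]
      linarith
    have h5 : (n k : ℝ) * d k * (|ρ k| / 2) * |ρ k| ≤ n k * d k * q k * |ρ k| := by
      gcongr; linarith
    have h6 : (n k : ℝ) * d k * (|ρ k| / 2) * |ρ k| = n k * (ρ k ^ 2 * d k) / 2 := by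
      rw [← sq_abs]; ring
    have h7 : (n k : ℝ) * (1 / 2) ≤ n k * (ρ k ^ 2 * d k) := by gcongr
    linarith
  · rw [abs_of_nonneg hpos] at hlt
    have hnd : (d k : ℝ) * m k ≤ n k * d k := by
      rw [mul_comm (n k : ℝ)]
      gcongr
      exact_mod_cast hmn k
    have hx0 : 0 ≤ n k * d k * q k * ρ k := by positivity
    -- Factor `(n d q ρ)² = (n d q²)(n ρ² d)`, where the second factor is at least `1/2`.
    have hsq : n k * d k * q k ^ 2 ≤ 2 * M ^ 2 := by
      have h1 : (n k * d k * q k * ρ k) ^ 2 ≤ M ^ 2 := by gcongr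
      have h2 : n k * d k * q k ^ 2 * (1 / 2) ≤
          n k * d k * q k ^ 2 * (n k * (ρ k ^ 2 * d k)) := by
        gcongr
        nlinarith
      nlinarith
    set r : ℝ := pairMass (q k) (ρ k) (true, true) with hr
    have hr0 : 0 ≤ r := pairMass_nonneg (h k) _
    have hr1 : r ≤ q k ^ 2 + q k * ρ k := by
      simp only [hr, pairMass]
      nlinarith [mul_nonneg hq0 (mul_nonneg hpos hq0)]
    have hr2 : r ≤ 1 / 2 := by
      refine le_trans ?_ (hq k)
      simp only [hr, pairMass]
      refine mul_le_of_le_one_right hq0 ?_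
      nlinarith [(h k).2.2.2, hq k]
    have htr := sum_altMass_le_of_truncation (h k) (hq k) hpos T
    have hall := sum_altMass (d := d k) (q k) (ρ k) (hmn k)
    rw [← Finset.sum_add_sum_compl T] at hall
    have hKle : (1 + 2 * ρ k * q k) ^ (d k * m k) ≤ K := by
      calc (1 + 2 * ρ k * q k) ^ (d k * m k) ≤ Real.exp (2 * ρ k * q k) ^ (d k * m k) := by
            gcongr
            linarith [Real.add_one_le_exp (2 * ρ k * q k)]
        _ = Real.exp (d k * m k * (2 * ρ k * q k)) := by
            rw [← Real.exp_nat_mul]; push_cast; rfl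
        _ ≤ K := by
            refine Real.exp_le_exp.2 ?_
            have : d k * m k * (2 * ρ k * q k) ≤ n k * d k * (2 * ρ k * q k) := by gcongr
            linarith
    have hsle : s ≤ (1 - r) ^ (d k * m k) := by
      calc s ≤ Real.exp (d k * m k * (-(2 * r))) := by
            refine Real.exp_le_exp.2 ?_
            have h1 : d k * m k * r ≤ n k * d k * (q k ^ 2 + q k * ρ k) := by gcongr
            linarith
        _ = Real.exp (-(2 * r)) ^ (d k * m k) := by
            rw [← Real.exp_nat_mul]; push_cast; rfl
        _ ≤ _ := by
            gcongr
            rw [Real.exp_neg, inv_le_iff_one_le_mul₀ (Real.exp_pos _)]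
            exact one_le_one_sub_mul_exp hr0 hr2
    have hN : 0 ≤ ∑ z ∈ T, nullMass (q k) z :=
      Finset.sum_nonneg fun z _ => nullMass_nonneg hq0 (h k).2.1 z
    have h1 : (1 + 2 * ρ k * q k) ^ (d k * m k) * ∑ z ∈ T, nullMass (q k) z ≤
        K * (s / (K + 1)) := by gcongr
    have h2 : K * (s / (K + 1)) + s / (K + 1) = s := by field_simp
    linarith

end BrokenSample

theorem mainTheorem5
    (α : ℝ) (hα0 : 0 < α) (hα1 : α ≤ 1)
    (n : ℕ → ℕ) (hn : Tendsto n atTop atTop)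
    (q ρ : ℕ → ℝ)
    (hqρ : ∀ k, BrokenSample.Admissible (q k) (ρ k))
    (hq : ∀ k, q k ≤ 1 / 2) :
    (∀ d : ℕ, 1 ≤ d →
      (BrokenSample.StrongDetection
          (fun k => BrokenSample.bernoulliModel d (q k) (ρ k)) n (fun k => ⌊α * (n k : ℝ)⌋₊) ↔
        α = 1 ∧
        Tendsto (fun k => ρ k ^ 2) atTop (𝓝 1) ∧
        Tendsto (fun k => (n k : ℝ) * q k) atTop atTop)) ∧
    (∀ d : ℕ → ℕ, Tendsto d atTop atTop →
      (BrokenSample.StrongDetection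
          (fun k => BrokenSample.bernoulliModel (d k) (q k) (ρ k)) n
          (fun k => ⌊α * (n k : ℝ)⌋₊) ↔
        Tendsto (fun k => ρ k ^ 2 * (d k : ℝ)) atTop atTop ∧
        Tendsto (fun k => (n k : ℝ) * (d k : ℝ) * q k * |ρ k|) atTop atTop)) := by
  have hρ : ∀ k, |ρ k| ≤ 1 := fun k => BrokenSample.abs_le_one_of_admissible (hqρ k) (hq k)
  have hmn : ∀ k, ⌊α * (n k : ℝ)⌋₊ ≤ n k := fun k => BrokenSample.floor_mul_le hα1 (n k)
  refine ⟨fun d hd => ⟨fun hSD => ?_, ?_⟩, fun d hd => ⟨fun hSD => ?_, fun ⟨h1, h2⟩ =>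
    BrokenSample.strongDetection_of_tendsto hα0 hα1 hn hqρ hq hd h1 h2⟩⟩
  · obtain ⟨h1, h2⟩ := BrokenSample.tendsto_sq_one_and_eq_one hα0 hα1 hqρ hρ hn hSD
    have hd1 : (1 : ℝ) ≤ d := by exact_mod_cast hd
    have h3 : ∀ᶠ k in atTop, 1 / 2 ≤ ρ k ^ 2 * (d : ℝ) := by
      filter_upwards [h2.eventually_const_lt (show (1 / 2 : ℝ) < 1 by norm_num)] with k hk
      nlinarith
    have h4 := BrokenSample.tendsto_mul_abs_atTop (d := fun _ => d) hqρ hq hmn hn h3 hSD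
    refine ⟨h1, h2, ?_⟩
    -- The constant `d` is divided out, and `|ρ| ≤ 1` gives `n q ≥ n q |ρ|`.
    refine tendsto_atTop_mono (fun k => ?_)
      (h4.const_mul_atTop (show (0 : ℝ) < (d : ℝ)⁻¹ by positivity))
    have h5 : (d : ℝ)⁻¹ * (n k * d * q k * |ρ k|) = n k * q k * |ρ k| := by field_simp
    rw [h5]
    exact mul_le_of_le_one_right (mul_nonneg (Nat.cast_nonneg _) (hqρ k).1) (hρ k)
  · rintro ⟨rfl, h1, h2⟩
    exact BrokenSample.strongDetection_of_tendsto_one hd (fun k => by simp) hqρ hq h1 h2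
  · have h1 := BrokenSample.tendsto_sq_mul_atTop hqρ hmn hn hd hSD
    exact ⟨h1, BrokenSample.tendsto_mul_abs_atTop hqρ hq hmn hn (h1.eventually_ge_atTop _) hSD⟩
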